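/- Let $d\ge 2$ be an integer and $\epsilon\in[0,1]$. For a unitary $U\in U(d)$ write $\Upsilon_U(\rho)=U\rho U^\dagger$. For channels $\mathcal A,\mathcal B$ on $L(\mathbb C^d)$ let $$\tfrac12\|\mathcal A-\mathcal B\|_\diamond=\max_{\Phi}\tfrac12\operatorname{tr}\sqrt{MM^\dagger},\qquad M=((\mathcal A-\mathcal B)\otimes \mathrm{id})(|\Phi\rangle\langle\Phi|),$$ the maximum being over unit vectors $\Phi\in\mathbb C^d\otimes\mathbb C^d$. For a set $\mathcal S$ of unitary channels on $L(\mathbb C^d)$ and a unitary channel $\Upsilon$ put $$D(\Upsilon,\mathcal S)=\inf_{\Gamma\in\mathcal S}\tfrac12\|\Upsilon-\Gamma\|_\diamond,\qquad P(\Upsilon,\mathcal S)=\inf_{\Lambda\in\operatorname{conv}\mathcal S}\tfrac12\|\Upsilon-\Lambda\|_\diamond$$ (for finite $\mathcal S$, $P$ is the infimum over probability distributions on $\mathcal S$). Put $L_d(e)=\frac{4\delta}{d}\left(1-\frac{\delta}{d}\right)$ with $\delta=1-\sqrt{1-e^2}$. Below, $\max_\Upsilon$ is over all unitary channels on $L(\mathbb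 C^d)$, and part of each claim is that the maximum is attained. (Lower bound.) Let $\mathcal W=\{\Upsilon_W: W\in U(d),\ \min_{z\in\operatorname{conv}\lambda(W)}|z|\le\sqrt{1-\epsilon^2}\}$, where $\lambda(W)$ is the set of eigenvalues of $W$. Then: 1. $D(\mathrm{id},\mathcal W)=\max_\Upsilon D(\Upsilon,\mathcal W)=\epsilon$ and $P(\mathrm{id},\mathcal W)=\max_\Upsilon P(\Upsilon,\mathcal W)=L_d(\epsilon)$. 2. For every $\eta>0$ there is a nonempty finite $S\subseteq\mathcal W$ such that $|D(\mathrm{id},S)-\epsilon|\le\eta$, $|P(\mathrm{id},S)-L_d(D(\mathrm{id},S))|\le\eta$, and, with $e=\max_\Upsilon D(\Upsilon,S)$, also $|e-\epsilon|\le\eta$ and $|\max_\Upsilon P(\Upsilon,S)-L_d(e)|\le\eta$. 3. For every unitary channel $\Upsilon$, the set $\Upsilon\circ\mathcal W=\{\Upsilon\circ\Gamma:\Gamma\in\mathcal W\}$ satisfies $D(\Upsilon,\Upsilon\circ\mathcal W)=\epsilon$ and $P(\Upsilon,\Upsilon\circ\mathcal W)=L_d(\epsilon)$, and for every $\eta>0$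 there is a nonempty finite $S\subseteq\Upsilon\circ\mathcal W$ with $|D(\Upsilon,S)-\epsilon|\le\eta$ and $|P(\Upsilon,S)-L_d(D(\Upsilon,S))|\le\eta$. (Upper bound.) Let $\mathcal V$ be the set of all $\Upsilon_V$ with $$V=\begin{pmatrix}1&0\\0&V_1\end{pmatrix}\begin{pmatrix}R_\theta&0\\0&\mathbb I_{d-2}\end{pmatrix}\begin{pmatrix}1&0\\0&V_2\end{pmatrix},\quad R_\theta=\begin{pmatrix}\cos\theta&-\sin\theta\\ \sin\theta&\cos\theta\end{pmatrix},\quad V_1,V_2\in U(d-1),\ 0\le\theta\le\arccos\epsilon .$$ Then: 4. $\max_\Upsilon D(\Upsilon,\mathcal V)=\epsilon$ and $\max_\Upsilon P(\Upsilon,\mathcal V)=\epsilon^2$. 5. For every $\eta>0$ there is a nonempty finite $S\subseteq\mathcal V$ such that, with $e=\max_\Upsilon D(\Upsilon,S)$, one has $|e-\epsilon|\le\eta$ and $|\max_\Upsilon P(\Upsilon,S)-e^2|\le\eta$. -/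

import Mathlib

open scoped MatrixOrder ComplexOrder Matrix Kronecker

namespace ProbSynth

noncomputable section

/-- Linear maps `L(ℂ^d) → L(ℂ^d)`, in the matrix representation. -/
abbrev SuperOp (d : ℕ) : Type :=
  Matrix (Fin d) (Fin d) ℂ →ₗ[ℂ] Matrix (Fin d) (Fin d) ℂ

/-- The unitary transformation (channel) `ρ ↦ U ρ U†`. -/
def unitaryChannel {d : ℕ} (U : Matrix (Fin d) (Fin d) ℂ) : SuperOp d where
  toFun ρ := U * ρ * Uᴴ
  map_add' ρ σ := by rw [mul_add, add_mul]
  map_smul' c ρ := by simp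

/-- `Ξ ⊗ id`, acting on operators on `ℂ^d ⊗ ℂ^k`. -/
def tensorId {d : ℕ} {k : Type*} (Ξ : SuperOp d) (M : Matrix (Fin d × k) (Fin d × k) ℂ) :
    Matrix (Fin d × k) (Fin d × k) ℂ :=
  Matrix.of fun p q => Ξ (Matrix.of fun i j => M (i, p.2) (j, q.2)) p.1 q.1

theorem tensorId_kronecker {d : ℕ} {k : Type*} (Ξ : SuperOp d)
    (A : Matrix (Fin d) (Fin d) ℂ) (B : Matrix k k ℂ) :
    tensorId Ξ (A ⊗ₖ B) = Ξ A ⊗ₖ B := by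
  ext p q
  have h : (Matrix.of fun i j => (A ⊗ₖ B) (i, p.2) (j, q.2)) = B p.2 q.2 • A := by
    ext i j
    simp [Matrix.kroneckerMap_apply, mul_comm]
  change Ξ (Matrix.of fun i j => (A ⊗ₖ B) (i, p.2) (j, q.2)) p.1 q.1 = _
  rw [h, map_smul, Matrix.smul_apply, smul_eq_mul, mul_comm, Matrix.kroneckerMap_apply]

/-- The quantity `(1/2) tr √(M M†)`; for `M = ρ - σ` it is the trace distance. -/
def trDist {n : Type*} [Fintype n] [DecidableEq n] (M : Matrix n n ℂ) : ℝ :=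
  (1 / 2) * (CFC.sqrt (M * Mᴴ)).trace.re

/-- `(1/2) ‖𝒜 - ℬ‖_⋄` for channels `𝒜, ℬ` on `L(ℂ^d)`: the maximum over pure states
`|Φ⟩⟨Φ|` of `ℂ^d ⊗ ℂ^d` of the trace distance of `(𝒜 ⊗ id)(|Φ⟩⟨Φ|)` and `(ℬ ⊗ id)(|Φ⟩⟨Φ|)`. -/
def diamondDist {d : ℕ} (𝒜 ℬ : SuperOp d) : ℝ :=
  sSup {t : ℝ | ∃ Φ : Fin d × Fin d → ℂ, star Φ ⬝ᵥ Φ = 1 ∧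
    t = trDist (tensorId (𝒜 - ℬ) (Matrix.vecMulVec Φ (star Φ)))}

/-- `inf_{Γ ∈ 𝒮} (1/2) ‖Υ - Γ‖_⋄`: the error of deterministic approximation of `Υ`. -/
def detError {d : ℕ} (Υ : SuperOp d) (𝒮 : Set (SuperOp d)) : ℝ :=
  sInf ((fun Γ => diamondDist Υ Γ) '' 𝒮)

/-- `inf_{Λ ∈ conv 𝒮} (1/2) ‖Υ - Λ‖_⋄`: the error of probabilistic approximation of `Υ`. -/
def probError {d : ℕ} (Υ : SuperOp d) (𝒮 : Set (SuperOp d)) : ℝ :=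
  sInf ((fun Λ => diamondDist Υ Λ) '' convexHull ℝ 𝒮)

/-- For a finite set, `probError` ranges over the mixtures `∑ p(x) Υ_x` with `p` a probability
distribution on the set. -/
theorem probError_finset {d : ℕ} (Υ : SuperOp d) (S : Finset (SuperOp d)) :
    probError Υ (S : Set (SuperOp d)) =
      sInf {t : ℝ | ∃ p : SuperOp d → ℝ, (∀ Γ ∈ S, 0 ≤ p Γ) ∧ ∑ Γ ∈ S, p Γ = 1 ∧
        t = diamondDist Υ (∑ Γ ∈ S, p Γ • Γ)} := by
  unfold probError
  congr 1
  ext t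
  simp only [Set.mem_image, Finset.mem_convexHull', Set.mem_ofPred_eq]
  constructor
  · rintro ⟨Λ, ⟨p, h0, h1, rfl⟩, rfl⟩
    exact ⟨p, h0, h1, rfl⟩
  · rintro ⟨p, h0, h1, rfl⟩
    exact ⟨_, ⟨p, h0, h1, rfl⟩, rfl⟩

/-- `e = max_Υ inf_{Γ ∈ 𝒮} (1/2) ‖Υ - Γ‖_⋄`, the maximum (attained) being over all unitary
channels `Υ` on `L(ℂ^d)`. -/
def IsWorstDetError {d : ℕ} (𝒮 : Set (SuperOp d)) (e : ℝ) : Prop :=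
  IsGreatest {t : ℝ | ∃ U ∈ Matrix.unitaryGroup (Fin d) ℂ, t = detError (unitaryChannel U) 𝒮} e

/-- `v = max_Υ inf_{Λ ∈ conv 𝒮} (1/2) ‖Υ - Λ‖_⋄`, the maximum (attained) being over all unitary
channels `Υ` on `L(ℂ^d)`. -/
def IsWorstProbError {d : ℕ} (𝒮 : Set (SuperOp d)) (v : ℝ) : Prop :=
  IsGreatest {t : ℝ | ∃ U ∈ Matrix.unitaryGroup (Fin d) ℂ, t = probError (unitaryChannel U) 𝒮} v

/-- `(4δ/d)(1 - δ/d)` with `δ = 1 - √(1 - ε²)`. -/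
def lowerBound (d : ℕ) (ε : ℝ) : ℝ :=
  4 * (1 - √(1 - ε ^ 2)) / d * (1 - (1 - √(1 - ε ^ 2)) / d)

/-- Unitaries `W ∈ U(d)` for which the minimum of `|z|` over the (compact) convex hull of the
eigenvalues of `W` is at most `√(1 - ε²)`. -/
def hullUnitaries (d : ℕ) (ε : ℝ) : Set (Matrix (Fin d) (Fin d) ℂ) :=
  {W | W ∈ Matrix.unitaryGroup (Fin d) ℂ ∧
    ∃ z ∈ convexHull ℝ (spectrum ℂ W), ‖z‖ ≤ √(1 - ε ^ 2)}

/-- The block-diagonal matrix with diagonal blocks `A` (first) and `B` (second). -/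
def blockDiag {a b d : ℕ} (h : a + b = d) (A : Matrix (Fin a) (Fin a) ℂ)
    (B : Matrix (Fin b) (Fin b) ℂ) : Matrix (Fin d) (Fin d) ℂ :=
  Matrix.reindex (finSumFinEquiv.trans (finCongr h)) (finSumFinEquiv.trans (finCongr h))
    (Matrix.fromBlocks A 0 0 B)

/-- The real rotation by the angle `θ`, as a complex `2 × 2` matrix. -/
def rotation (θ : ℝ) : Matrix (Fin 2) (Fin 2) ℂ :=
  !![(Real.cos θ : ℂ), -(Real.sin θ : ℂ); (Real.sin θ : ℂ), (Real.cos θ : ℂ)]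

/-- The products `(1 ⊕ V₁) (R(θ) ⊕ 𝕀_{d-2}) (1 ⊕ V₂)` with `V₁, V₂ ∈ U(d-1)` and
`0 ≤ θ ≤ arccos ε`. -/
def rotationUnitaries (d : ℕ) (hd : 2 ≤ d) (ε : ℝ) : Set (Matrix (Fin d) (Fin d) ℂ) :=
  {V | ∃ V₁ ∈ Matrix.unitaryGroup (Fin (d - 1)) ℂ, ∃ V₂ ∈ Matrix.unitaryGroup (Fin (d - 1)) ℂ,
    ∃ θ : ℝ, 0 ≤ θ ∧ θ ≤ Real.arccos ε ∧
      V = blockDiag (show 1 + (d - 1) = d by omega) 1 V₁ *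
        blockDiag (show 2 + (d - 2) = d by omega) (rotation θ) 1 *
        blockDiag (show 1 + (d - 1) = d by omega) 1 V₂}

/-- The unitary channels of the unitaries in `hullUnitaries d ε`. -/
def hullChannels (d : ℕ) (ε : ℝ) : Set (SuperOp d) :=
  unitaryChannel '' hullUnitaries d ε

/-- The unitary channels of the unitaries in `rotationUnitaries d hd ε`. -/
def rotationChannels (d : ℕ) (hd : 2 ≤ d) (ε : ℝ) : Set (SuperOp d) :=
  unitaryChannel '' rotationUnitaries d hd ε

end

end ProbSynth

/-! Write `c = √(1 - ε²)`. Each of the four error values is bounded from above by an explicit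
construction valid for every target and from below by one test state at one target.

Upper bounds on the probabilistic error come from Jensen's inequality for a positive quadratic form:
if a mixture of unitary matrices `W x` equals `μ U`, the same mixture of channels lies within `1 -
μ²` of the channel of `U` (`diamondDist_mixture_le`). Lower bounds come from measuring the output of
a state `Φ` against the ideal output: the success probability is affine in the channel, so a bound
on the overlaps `|⟨Φ, (U†W ⊗ 1) Φ⟩|²` over the generators passes to the convex hull
(`le_probError`).

For the hull set, diagonalize the target `U` and follow it by rotations in the planes of consecutive
eigenvectors, taken cyclically and with both signs. Each rotated unitary has `c` times an eigenvalue
of `U` in its numerical range, hence lies in the set, and its relative rotation has Hermitian part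
at least `c`, hence distance at most `ε`. Their average is `μ U` with `μ = 1 - 2(1 - c)/d`, and `1 -
μ²` is `lowerBound d ε`. Conversely, at the identity the maximally entangled state has overlap `|tr
W|/d`, and `|tr W| ≤ d - 2 + 2c` whenever the hull of the eigenvalues comes within `c` of `0`
(`norm_sum_le_of_norm_convexCombination_le`).

The rotation set consists of the channels of the unitaries `V` with `|V 0 0| ≥ ε`. Once the phase of
`U` makes `U 0 0` real, there is a Hermitian unitary `H` with `(U H) 0 0 = 1`. The unitaries `U (c ±
iεH)` then belong to the set, are within `ε` of `U`, and average to `c U`, which gives `1 - c² =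
ε²`. The extremal target exchanges the first two basis vectors up to a phase, so its overlap on the
first basis vector is `|V 1 0|² ≤ 1 - ε²`.

Finite subsets are nets in the compact unitary group: joint convexity of the distance carries a net
over to convex hulls, both errors are 1-Lipschitz in the target, and the claimed relation is
continuous in the error. -/

namespace ProbSynth

/-! ### Unitary diagonalization of isometries and unitary matrices -/

section Diagonalization

/-- An isometry preserves orthogonality to its eigenvectors, so this complement is invariant; were
it nonzero, it would contain an eigenvector, which would be orthogonal to itself. -/
theorem orthogonal_iSup_eigenspace_eq_bot {E : Type*} [NormedAddCommGroup E]
    [InnerProductSpace ℂ E] [FiniteDimensional ℂ E] (T : E →ₗ[ℂ] E)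
    (hT : ∀ x y, inner ℂ (T x) (T y) = inner ℂ x y) :
    (⨆ μ : ℂ, Module.End.eigenspace T μ)ᗮ = ⊥ := by
  set M := ⨆ μ : ℂ, Module.End.eigenspace T μ with hM
  have hmem : ∀ μ v, T v = μ • v → v ∈ M := fun μ v h =>
    Submodule.mem_iSup_of_mem μ (Module.End.mem_eigenspace_iff.2 h)
  have hinv : ∀ x ∈ Mᗮ, T x ∈ Mᗮ := by
    intro x hx
    have hle : M ≤ (Submodule.span ℂ {T x})ᗮ := by
      refine iSup_le fun μ v hv => ?_
      rw [Submodule.mem_orthogonal_singleton_iff_inner_left]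
      have hv' : T v = μ • v := Module.End.mem_eigenspace_iff.1 hv
      have h1 : inner ℂ (T v) (T x) = 0 := by
        rw [hT]; exact (Submodule.mem_orthogonal _ _).1 hx v (hmem μ v hv')
      rw [hv', inner_smul_left] at h1
      rcases mul_eq_zero.1 h1 with h | h
      · have h0 : T v = 0 := by rw [hv', (map_eq_zero _).1 h, zero_smul]
        have : inner ℂ v v = (0 : ℂ) := by rw [← hT, h0, inner_zero_left]
        rw [inner_self_eq_zero.1 this, inner_zero_left]
      · exact h
    rw [Submodule.mem_orthogonal]
    intro v hv
    exact (Submodule.mem_orthogonal_singleton_iff_inner_left).1 (hle hv)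
  by_contra hne
  have : Nontrivial (Mᗮ : Submodule ℂ E) := Submodule.nontrivial_iff_ne_bot.2 hne
  obtain ⟨μ, hμ⟩ := Module.End.exists_eigenvalue (T.restrict hinv)
  obtain ⟨v, hv⟩ := hμ.exists_hasEigenvector
  have h1 : T v = μ • (v : E) := by
    simpa using congrArg Subtype.val hv.apply_eq_smul
  have h2 : inner ℂ (v : E) (v : E) = (0 : ℂ) :=
    (Submodule.mem_orthogonal _ _).1 v.2 v (hmem μ v h1)
  exact hv.2 (Subtype.ext (inner_self_eq_zero.1 h2))

theorem exists_orthonormalBasis_eigenvectors {E : Type*} [NormedAddCommGroup E]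
    [InnerProductSpace ℂ E] [FiniteDimensional ℂ E] {n : ℕ} (hn : Module.finrank ℂ E = n)
    (T : E →ₗ[ℂ] E) (hT : ∀ x y, inner ℂ (T x) (T y) = inner ℂ x y) :
    ∃ (b : OrthonormalBasis (Fin n) ℂ E) (u : Fin n → ℂ), ∀ i, T (b i) = u i • b i := by
  have hO : OrthogonalFamily ℂ (fun μ : Module.End.Eigenvalues T =>
      (Module.End.eigenspace T μ : Submodule ℂ E))
      fun μ => (Module.End.eigenspace T μ).subtypeₗᵢ := by
    refine OrthogonalFamily.of_pairwise fun μ ν hμν => ?_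
    change Module.End.eigenspace T μ ⟂ Module.End.eigenspace T ν
    rw [Submodule.isOrtho_iff_inner_eq]
    intro x hx y hy
    rw [Module.End.mem_eigenspace_iff] at hx hy
    obtain ⟨w, hw⟩ := Module.End.HasEigenvalue.exists_hasEigenvector (f := T) (μ := μ) μ.2
    have hw1 : T w = (μ : ℂ) • w := hw.apply_eq_smul
    -- Eigenvalues have modulus one. If `x` and `y` were not orthogonal, the same computation would
    -- give `conj μ * ν = 1`, hence `μ = ν`.
    have h1 : (starRingEnd ℂ (μ : ℂ)) * (μ : ℂ) = 1 := by
      have h := hT w w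
      rw [hw1, inner_smul_left, inner_smul_right, ← mul_assoc] at h
      exact mul_right_cancel₀ (inner_self_ne_zero.2 hw.2) (h.trans (one_mul _).symm)
    have h := hT x y
    rw [hx, hy, inner_smul_left, inner_smul_right, ← mul_assoc] at h
    by_contra h0
    have h2 : (starRingEnd ℂ (μ : ℂ)) * (ν : ℂ) = 1 :=
      mul_right_cancel₀ h0 (h.trans (one_mul _).symm)
    have h3 : (starRingEnd ℂ (μ : ℂ)) ≠ 0 := left_ne_zero_of_mul_eq_one h1
    exact hμν (Subtype.ext (mul_left_cancel₀ h3 (h1.trans h2.symm)))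
  have hI : DirectSum.IsInternal (fun μ : Module.End.Eigenvalues T =>
      (Module.End.eigenspace T μ : Submodule ℂ E)) := by
    rw [hO.isInternal_iff, ← orthogonal_iSup_eigenspace_eq_bot T hT]
    congr 1
    refine le_antisymm (iSup_le fun μ => le_iSup (Module.End.eigenspace T) (μ : ℂ))
      (iSup_le fun μ => ?_)
    by_cases hμ : Module.End.HasEigenvalue T μ
    · exact le_iSup (fun μ : Module.End.Eigenvalues T =>
        (Module.End.eigenspace T μ : Submodule ℂ E)) ⟨μ, hμ⟩
    · rw [Module.End.hasEigenvalue_iff, not_not] at hμ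
      rw [hμ]; exact bot_le
  refine ⟨hI.subordinateOrthonormalBasis hn hO,
    fun i => Module.End.Eigenvalues.val T (hI.subordinateOrthonormalBasisIndex hn i hO),
    fun i => ?_⟩
  exact Module.End.mem_eigenspace_iff.1 (hI.subordinateOrthonormalBasis_subordinate hn i hO)

variable {d : ℕ}

theorem star_mulVec_dotProduct_mulVec {m n : Type*} [Fintype m] [Fintype n]
    (A B : Matrix m n ℂ) (x y : n → ℂ) :
    star (A *ᵥ x) ⬝ᵥ (B *ᵥ y) = star x ⬝ᵥ ((Aᴴ * B) *ᵥ y) := by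
  rw [Matrix.star_mulVec, ← Matrix.dotProduct_mulVec, Matrix.mulVec_mulVec]

theorem matrixOf_orthonormalBasis_mem_unitaryGroup
    (b : OrthonormalBasis (Fin d) ℂ (EuclideanSpace ℂ (Fin d))) :
    Matrix.of (fun i j => b j i) ∈ Matrix.unitaryGroup (Fin d) ℂ := by
  rw [Matrix.mem_unitaryGroup_iff']
  ext i j
  have h := b.inner_eq_ite i j
  rw [EuclideanSpace.inner_eq_star_dotProduct, dotProduct_comm] at h
  simpa [Matrix.mul_apply, dotProduct, Matrix.one_apply] using h

theorem exists_unitary_diagonal {W : Matrix (Fin d) (Fin d) ℂ}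
    (hW : W ∈ Matrix.unitaryGroup (Fin d) ℂ) :
    ∃ Q ∈ Matrix.unitaryGroup (Fin d) ℂ, ∃ u : Fin d → ℂ, (∀ j, ‖u j‖ = 1) ∧
      W * Q = Q * Matrix.diagonal u ∧ W = Q * Matrix.diagonal u * Qᴴ := by
  have hT : ∀ x y : EuclideanSpace ℂ (Fin d),
      inner ℂ (Matrix.toLpLin 2 2 W x) (Matrix.toLpLin 2 2 W y) = inner ℂ x y := by
    intro x y
    simp only [Matrix.toLpLin_apply, EuclideanSpace.inner_eq_star_dotProduct]
    rw [dotProduct_comm, star_mulVec_dotProduct_mulVec, ← Matrix.star_eq_conjTranspose,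
      Matrix.mem_unitaryGroup_iff'.1 hW, Matrix.one_mulVec, dotProduct_comm]
  obtain ⟨b, u, hb⟩ := exists_orthonormalBasis_eigenvectors (n := d) (by simp) _ hT
  set Q : Matrix (Fin d) (Fin d) ℂ := Matrix.of fun i j => b j i with hQ
  have hQm : Q ∈ Matrix.unitaryGroup (Fin d) ℂ := matrixOf_orthonormalBasis_mem_unitaryGroup b
  have hWQ : W * Q = Q * Matrix.diagonal u := by
    ext i j
    have h := congrArg (fun v : EuclideanSpace ℂ (Fin d) => v i) (hb j)
    simp only [Matrix.toLpLin_apply, Matrix.mulVec, dotProduct, PiLp.smul_apply,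
      smul_eq_mul] at h
    rw [Matrix.mul_diagonal, mul_comm]
    simpa [Matrix.mul_apply, hQ] using h
  have hu : ∀ j, ‖u j‖ = 1 := by
    intro j
    have h := hT (b j) (b j)
    rw [hb j, inner_smul_left, inner_smul_right, b.inner_eq_one, mul_one, mul_comm,
      Complex.mul_conj, Complex.normSq_eq_norm_sq] at h
    have h' : ‖u j‖ ^ 2 = 1 := by exact_mod_cast h
    nlinarith [norm_nonneg (u j)]
  refine ⟨Q, hQm, u, hu, hWQ, ?_⟩
  rw [← hWQ, mul_assoc, ← Matrix.star_eq_conjTranspose, Matrix.mem_unitaryGroup_iff.1 hQm,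
    mul_one]

end Diagonalization

/-! ### Trace distance through effects, and its value on pure states -/

section TraceDistance

variable {n : Type*} [Fintype n] [DecidableEq n]

/-- An effect: a matrix `E` with `0 ≤ E ≤ 1`. -/
def IsEffect (E : Matrix n n ℂ) : Prop := E.PosSemidef ∧ (1 - E).PosSemidef

theorem exists_isHermitian_diagonal {M : Matrix n n ℂ} (hM : M.IsHermitian) :
    ∃ (Q : Matrix n n ℂ) (l : n → ℝ), Qᴴ * Q = 1 ∧ Q * Qᴴ = 1 ∧
      M = Q * Matrix.diagonal (fun i => (l i : ℂ)) * Qᴴ := by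
  refine ⟨hM.eigenvectorUnitary, hM.eigenvalues, ?_, ?_, ?_⟩
  · exact Matrix.mem_unitaryGroup_iff'.1 hM.eigenvectorUnitary.2
  · exact Matrix.mem_unitaryGroup_iff.1 hM.eigenvectorUnitary.2
  · exact hM.spectral_theorem

theorem trace_conj_diagonal {Q : Matrix n n ℂ} (hQ : Qᴴ * Q = 1) (l : n → ℂ) :
    (Q * Matrix.diagonal l * Qᴴ).trace = ∑ i, l i := by
  rw [mul_assoc, Matrix.trace_mul_comm, mul_assoc, hQ, mul_one, Matrix.trace_diagonal]

theorem posSemidef_conj_diagonal (Q : Matrix n n ℂ) {l : n → ℝ} (hl : ∀ i, 0 ≤ l i) :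
    (Q * Matrix.diagonal (fun i => (l i : ℂ)) * Qᴴ).PosSemidef := by
  refine Matrix.PosSemidef.mul_mul_conjTranspose_same ?_ Q
  exact Matrix.PosSemidef.diagonal fun i => by
    change (0 : ℂ) ≤ (l i : ℂ)
    exact_mod_cast hl i

theorem conj_diagonal_mul_conj_diagonal {Q : Matrix n n ℂ} (hQ : Qᴴ * Q = 1) (k l : n → ℂ) :
    (Q * Matrix.diagonal k * Qᴴ) * (Q * Matrix.diagonal l * Qᴴ) =
      Q * Matrix.diagonal (fun i => k i * l i) * Qᴴ := by
  calc _ = Q * Matrix.diagonal k * (Qᴴ * Q) * Matrix.diagonal l * Qᴴ := by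
        simp only [mul_assoc]
    _ = _ := by rw [hQ, mul_one, mul_assoc Q, Matrix.diagonal_mul_diagonal]

theorem trDist_conj_diagonal {Q : Matrix n n ℂ} (hQ : Qᴴ * Q = 1) (l : n → ℝ) :
    trDist (Q * Matrix.diagonal (fun i => (l i : ℂ)) * Qᴴ) = (1 / 2) * ∑ i, |l i| := by
  have hs : CFC.sqrt ((Q * Matrix.diagonal (fun i => (l i : ℂ)) * Qᴴ) *
      (Q * Matrix.diagonal (fun i => (l i : ℂ)) * Qᴴ)ᴴ) =
      Q * Matrix.diagonal (fun i => ((|l i| : ℝ) : ℂ)) * Qᴴ := by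
    refine CFC.sqrt_unique ?_
      (Matrix.nonneg_iff_posSemidef.2 (posSemidef_conj_diagonal Q fun i => abs_nonneg _))
    have hH : (Q * Matrix.diagonal (fun i => (l i : ℂ)) * Qᴴ)ᴴ =
        Q * Matrix.diagonal (fun i => (l i : ℂ)) * Qᴴ := by
      rw [Matrix.conjTranspose_mul, Matrix.conjTranspose_mul, Matrix.conjTranspose_conjTranspose,
        Matrix.diagonal_conjTranspose, mul_assoc]
      congr 3
      funext i
      simp
    rw [hH, conj_diagonal_mul_conj_diagonal hQ, conj_diagonal_mul_conj_diagonal hQ]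
    congr 3
    funext i
    rw [← Complex.ofReal_mul, abs_mul_abs_self, Complex.ofReal_mul]
  rw [trDist, hs, trace_conj_diagonal hQ, ← Complex.ofReal_sum, Complex.ofReal_re]

/-- In an eigenbasis of `M` the diagonal entries of `E` lie in `[0, 1]`, so the trace is at most the
sum of the positive eigenvalues. Tracelessness makes that sum half the sum of the absolute values.
-/
theorem re_trace_mul_le_trDist {M E : Matrix n n ℂ} (hM : M.IsHermitian) (h0 : M.trace = 0)
    (hE : IsEffect E) : (E * M).trace.re ≤ trDist M := by
  obtain ⟨Q, l, hQ, hQ', rfl⟩ := exists_isHermitian_diagonal hM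
  rw [trDist_conj_diagonal hQ]
  rw [trace_conj_diagonal hQ, ← Complex.ofReal_sum, Complex.ofReal_eq_zero] at h0
  have h1 : (Qᴴ * E * Q).PosSemidef := hE.1.conjTranspose_mul_mul_same Q
  have h2 : (Qᴴ * (1 - E) * Q).PosSemidef := hE.2.conjTranspose_mul_mul_same Q
  rw [mul_sub, sub_mul, mul_one, hQ] at h2
  have h3 : (E * (Q * Matrix.diagonal (fun i => (l i : ℂ)) * Qᴴ)).trace.re =
      ∑ i, ((Qᴴ * E * Q) i i).re * l i := by
    have : (E * (Q * Matrix.diagonal (fun i => (l i : ℂ)) * Qᴴ)).trace =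
        ((Qᴴ * E * Q) * Matrix.diagonal (fun i => (l i : ℂ))).trace := by
      rw [← mul_assoc, Matrix.trace_mul_comm]
      simp only [mul_assoc]
    rw [this, Matrix.trace, Complex.re_sum]
    refine Finset.sum_congr rfl fun i _ => ?_
    rw [Matrix.diag_apply, Matrix.mul_diagonal, Complex.re_mul_ofReal]
  rw [h3]
  have h4 : ∀ i, ((Qᴴ * E * Q) i i).re * l i ≤ (1 / 2) * (|l i| + l i) := by
    intro i
    have a0 : 0 ≤ ((Qᴴ * E * Q) i i).re := (Complex.le_def.1 (h1.diag_nonneg (i := i))).1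
    have a1 : ((Qᴴ * E * Q) i i).re ≤ 1 := by
      have := (Complex.le_def.1 (h2.diag_nonneg (i := i))).1
      simpa using this
    rcases abs_cases (l i) with ⟨h, h'⟩ | ⟨h, h'⟩ <;> rw [h] <;> nlinarith
  calc _ ≤ ∑ i, (1 / 2) * (|l i| + l i) := Finset.sum_le_sum fun i _ => h4 i
    _ = _ := by rw [← Finset.mul_sum, Finset.sum_add_distrib, h0, add_zero]

/-- The optimal effect is the projection onto the eigenvectors with positive eigenvalue. -/
theorem exists_isEffect_trDist_eq {M : Matrix n n ℂ} (hM : M.IsHermitian) (h0 : M.trace = 0) :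
    ∃ E, IsEffect E ∧ trDist M = (E * M).trace.re := by
  obtain ⟨Q, l, hQ, hQ', rfl⟩ := exists_isHermitian_diagonal hM
  rw [trace_conj_diagonal hQ, ← Complex.ofReal_sum, Complex.ofReal_eq_zero] at h0
  refine ⟨Q * Matrix.diagonal (fun i => ((if 0 < l i then 1 else 0 : ℝ) : ℂ)) * Qᴴ, ⟨?_, ?_⟩, ?_⟩
  · exact posSemidef_conj_diagonal Q fun i => by split_ifs <;> norm_num
  · have h1 : 1 - Q * Matrix.diagonal (fun i => ((if 0 < l i then 1 else 0 : ℝ) : ℂ)) * Qᴴ =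
        Q * Matrix.diagonal (fun i => ((1 - (if 0 < l i then 1 else 0) : ℝ) : ℂ)) * Qᴴ := by
      have : Matrix.diagonal (fun i => ((1 - (if 0 < l i then 1 else 0) : ℝ) : ℂ)) =
          (1 : Matrix n n ℂ) -
            Matrix.diagonal (fun i => ((if 0 < l i then 1 else 0 : ℝ) : ℂ)) := by
        rw [← Matrix.diagonal_one, Matrix.diagonal_sub]
        congr 1
        funext i
        simp
      rw [this, mul_sub, sub_mul, mul_one, hQ']
    rw [h1]
    exact posSemidef_conj_diagonal Q fun i => by split_ifs <;> norm_num
  · rw [trDist_conj_diagonal hQ, conj_diagonal_mul_conj_diagonal hQ, trace_conj_diagonal hQ,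
      Complex.re_sum]
    have h2 : ∑ i, |l i| = ∑ i, (|l i| + l i) := by
      rw [Finset.sum_add_distrib, h0, add_zero]
    rw [h2, Finset.mul_sum]
    refine Finset.sum_congr rfl fun i _ => ?_
    rw [← Complex.ofReal_mul, Complex.ofReal_re]
    split_ifs with h
    · rw [abs_of_pos h]; ring
    · rw [abs_of_nonpos (not_lt.1 h)]; ring

theorem vecMulVec_star_mul_vecMulVec_star {m : Type*} [Fintype m] (a b c e : m → ℂ) :
    Matrix.vecMulVec a (star b) * Matrix.vecMulVec c (star e) =
      (star b ⬝ᵥ c) • Matrix.vecMulVec a (star e) := by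
  rw [Matrix.vecMulVec_mul_vecMulVec]
  ext i j
  simp only [Matrix.smul_apply, Matrix.vecMulVec_apply, smul_eq_mul, Pi.smul_apply]
  ring

/-- With `M = A - B` and `t` the squared overlap, `M³ = (1 - t) M`, so the positive root of `M²` is
`M² / √(1 - t)`, and `tr M² = 2(1 - t)`. If `t = 1`, the positive matrix `M²` has trace zero and
vanishes. -/
theorem trDist_pure {a b : n → ℂ} (ha : star a ⬝ᵥ a = 1) (hb : star b ⬝ᵥ b = 1) :
    trDist (Matrix.vecMulVec a (star a) - Matrix.vecMulVec b (star b)) =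
      √(1 - ‖star a ⬝ᵥ b‖ ^ 2) := by
  set A := Matrix.vecMulVec a (star a) with hA
  set B := Matrix.vecMulVec b (star b) with hB
  set t : ℝ := ‖star a ⬝ᵥ b‖ ^ 2 with ht
  have hab : (star a ⬝ᵥ b) * (star b ⬝ᵥ a) = (t : ℂ) := by
    have : star b ⬝ᵥ a = star (star a ⬝ᵥ b) := by
      exact Matrix.star_dotProduct _ _
    rw [this, ht, Complex.star_def, Complex.mul_conj, Complex.normSq_eq_norm_sq]
  have hAA : A * A = A := by rw [hA, vecMulVec_star_mul_vecMulVec_star, ha, one_smul]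
  have hBB : B * B = B := by rw [hB, vecMulVec_star_mul_vecMulVec_star, hb, one_smul]
  have hABA : A * B * A = (t : ℂ) • A := by
    rw [hA, hB, vecMulVec_star_mul_vecMulVec_star, smul_mul_assoc,
      vecMulVec_star_mul_vecMulVec_star, smul_smul, hab]
  have hBAB : B * A * B = (t : ℂ) • B := by
    rw [hA, hB, vecMulVec_star_mul_vecMulVec_star, smul_mul_assoc,
      vecMulVec_star_mul_vecMulVec_star, smul_smul, mul_comm, hab]
  have hAH : Aᴴ = A := (Matrix.posSemidef_vecMulVec_self_star a).isHermitian
  have hBH : Bᴴ = B := (Matrix.posSemidef_vecMulVec_self_star b).isHermitian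
  set M := A - B with hM
  have hMH : Mᴴ = M := by rw [hM, Matrix.conjTranspose_sub, hAH, hBH]
  have hM3 : M * M * M = ((1 - t : ℝ) : ℂ) • M := by
    have : M * M * M = A * A * A - A * A * B - A * B * A + A * (B * B) - B * (A * A) + B * A * B
        + B * B * A - B * B * B := by rw [hM]; noncomm_ring
    rw [this, hBAB, hABA]
    simp only [hAA, hBB]
    rw [hM]
    push_cast
    module
  have htr : (M * M).trace = ((2 * (1 - t) : ℝ) : ℂ) := by
    have h1 : M * M = A * A + B * B - A * B - B * A := by rw [hM]; noncomm_ring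
    have h2 : (A * B).trace = (t : ℂ) := by
      rw [hA, hB, vecMulVec_star_mul_vecMulVec_star, Matrix.trace_smul, Matrix.trace_vecMulVec,
        smul_eq_mul, dotProduct_comm a, hab]
    have h3 : A.trace = 1 := by rw [hA, Matrix.trace_vecMulVec, dotProduct_comm, ha]
    have h4 : B.trace = 1 := by rw [hB, Matrix.trace_vecMulVec, dotProduct_comm, hb]
    rw [h1, hAA, hBB, Matrix.trace_sub, Matrix.trace_sub, Matrix.trace_add,
      Matrix.trace_mul_comm B A, h2, h3, h4]
    push_cast
    ring
  have hMM : (M * M).PosSemidef := by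
    have := Matrix.posSemidef_self_mul_conjTranspose M
    rwa [hMH] at this
  have ht1 : 0 ≤ 1 - t := by
    have := (Complex.le_def.1 hMM.trace_nonneg).1
    rw [htr, Complex.ofReal_re, Complex.zero_re] at this
    linarith
  rcases ht1.eq_or_lt with h | h
  · have h0 : M * Mᴴ = 0 := by
      have : (M * M).trace = 0 := by rw [htr, ← h]; simp
      rw [hMH]; exact hMM.trace_eq_zero_iff.1 this
    rw [trDist, h0, CFC.sqrt_zero, ← h]; simp
  · set s := √(1 - t) with hs
    have hs0 : 0 < s := Real.sqrt_pos.2 h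
    have hs2 : s * s = 1 - t := Real.mul_self_sqrt ht1
    have hsq : CFC.sqrt (M * Mᴴ) = ((s⁻¹ : ℝ) : ℂ) • (M * M) := by
      refine CFC.sqrt_unique ?_ (Matrix.nonneg_iff_posSemidef.2 (hMM.smul ?_))
      · rw [hMH, smul_mul_smul_comm]
        have : M * M * (M * M) = M * M * M * M := by noncomm_ring
        rw [this, hM3, smul_mul_assoc, smul_smul, ← hs2, ← Complex.ofReal_mul,
          ← Complex.ofReal_mul]
        have : s⁻¹ * s⁻¹ * (s * s) = 1 := by field_simp
        rw [this, Complex.ofReal_one, one_smul]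
      · exact_mod_cast (inv_pos.2 hs0).le
    rw [trDist, hsq, Matrix.trace_smul, htr, smul_eq_mul, ← Complex.ofReal_mul,
      Complex.ofReal_re, ← hs2]
    field_simp

end TraceDistance

/-! ### Diamond distance: variational form, convexity, unitary invariance -/

section DiamondDistance

variable {d : ℕ}

/-- The output `(Λ ⊗ id)(|Φ⟩⟨Φ|)`. -/
def outState (Λ : SuperOp d) (Φ : Fin d × Fin d → ℂ) :
    Matrix (Fin d × Fin d) (Fin d × Fin d) ℂ :=
  tensorId Λ (Matrix.vecMulVec Φ (star Φ))

/-- The vector `(U ⊗ 1) Φ`. -/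
def localMul (U : Matrix (Fin d) (Fin d) ℂ) (Φ : Fin d × Fin d → ℂ) : Fin d × Fin d → ℂ :=
  (U ⊗ₖ (1 : Matrix (Fin d) (Fin d) ℂ)) *ᵥ Φ

theorem localMul_apply (U : Matrix (Fin d) (Fin d) ℂ) (Φ : Fin d × Fin d → ℂ) (i k : Fin d) :
    localMul U Φ (i, k) = ∑ j, U i j * Φ (j, k) := by
  rw [localMul, Matrix.mulVec, dotProduct, Fintype.sum_prod_type]
  refine Finset.sum_congr rfl fun j _ => ?_
  simp [Matrix.kroneckerMap_apply, Matrix.one_apply]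

theorem localMul_one (Φ : Fin d × Fin d → ℂ) : localMul 1 Φ = Φ := by
  rw [localMul, Matrix.one_kronecker_one, Matrix.one_mulVec]

theorem star_localMul_dotProduct (U V : Matrix (Fin d) (Fin d) ℂ) (Φ Ψ : Fin d × Fin d → ℂ) :
    star (localMul U Φ) ⬝ᵥ localMul V Ψ = star Φ ⬝ᵥ localMul (Uᴴ * V) Ψ := by
  rw [localMul, localMul, star_mulVec_dotProduct_mulVec, localMul, Matrix.conjTranspose_kronecker,
    ← Matrix.mul_kronecker_mul]
  simp

theorem star_localMul_dotProduct_self {U : Matrix (Fin d) (Fin d) ℂ}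
    (hU : U ∈ Matrix.unitaryGroup (Fin d) ℂ) (Φ Ψ : Fin d × Fin d → ℂ) :
    star (localMul U Φ) ⬝ᵥ localMul U Ψ = star Φ ⬝ᵥ Ψ := by
  rw [star_localMul_dotProduct, ← Matrix.star_eq_conjTranspose,
    Matrix.mem_unitaryGroup_iff'.1 hU, localMul_one]

theorem tensorId_sub (A B : SuperOp d) (M : Matrix (Fin d × Fin d) (Fin d × Fin d) ℂ) :
    tensorId (A - B) M = tensorId A M - tensorId B M := by
  ext; simp [tensorId]

theorem outState_add (A B : SuperOp d) (Φ : Fin d × Fin d → ℂ) :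
    outState (A + B) Φ = outState A Φ + outState B Φ := by
  ext; simp [outState, tensorId]

theorem outState_smul (r : ℝ) (A : SuperOp d) (Φ : Fin d × Fin d → ℂ) :
    outState (r • A) Φ = r • outState A Φ := by
  ext; simp [outState, tensorId]

theorem outState_sum {ι : Type*} (s : Finset ι) (p : ι → ℝ) (A : ι → SuperOp d)
    (Φ : Fin d × Fin d → ℂ) :
    outState (∑ x ∈ s, p x • A x) Φ = ∑ x ∈ s, p x • outState (A x) Φ := by
  classical
  induction s using Finset.induction_on with
  | empty => ext; simp [outState, tensorId]
  | insert a s ha ih =>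
    rw [Finset.sum_insert ha, Finset.sum_insert ha, outState_add, outState_smul, ih]

theorem tensorId_unitaryChannel_comp (U : Matrix (Fin d) (Fin d) ℂ) (A : SuperOp d)
    (M : Matrix (Fin d × Fin d) (Fin d × Fin d) ℂ) :
    tensorId (unitaryChannel U ∘ₗ A) M =
      (U ⊗ₖ (1 : Matrix (Fin d) (Fin d) ℂ)) * tensorId A M *
        (U ⊗ₖ (1 : Matrix (Fin d) (Fin d) ℂ))ᴴ := by
  ext ⟨i, k⟩ ⟨j, l⟩
  rw [Matrix.mul_apply, Fintype.sum_prod_type]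
  simp only [Matrix.mul_apply, Fintype.sum_prod_type, Matrix.conjTranspose_apply]
  simp [tensorId, unitaryChannel, Matrix.kroneckerMap_apply, Matrix.one_apply, Matrix.mul_apply,
    apply_ite]

theorem unitaryChannel_one : unitaryChannel (1 : Matrix (Fin d) (Fin d) ℂ) = LinearMap.id := by
  ext; simp [unitaryChannel]

theorem unitaryChannel_mul (U V : Matrix (Fin d) (Fin d) ℂ) :
    unitaryChannel (U * V) = unitaryChannel U ∘ₗ unitaryChannel V := by
  refine LinearMap.ext fun ρ => ?_
  simp [unitaryChannel, Matrix.conjTranspose_mul, mul_assoc]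

theorem unitaryChannel_smul {z : ℂ} (hz : ‖z‖ = 1) (U : Matrix (Fin d) (Fin d) ℂ) :
    unitaryChannel (z • U) = unitaryChannel U := by
  refine LinearMap.ext fun ρ => ?_
  have h : z * star z = 1 := by
    rw [Complex.star_def, Complex.mul_conj, Complex.normSq_eq_norm_sq, hz]; norm_num
  simp only [unitaryChannel, LinearMap.coe_mk, AddHom.coe_mk, Matrix.conjTranspose_smul,
    smul_mul_assoc, mul_smul_comm, smul_smul, h, mul_comm (star z), one_smul]

theorem outState_unitaryChannel (U : Matrix (Fin d) (Fin d) ℂ) (Φ : Fin d × Fin d → ℂ) :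
    outState (unitaryChannel U) Φ = Matrix.vecMulVec (localMul U Φ) (star (localMul U Φ)) := by
  have h := tensorId_unitaryChannel_comp U LinearMap.id (Matrix.vecMulVec Φ (star Φ))
  have hid : tensorId (LinearMap.id : SuperOp d) (Matrix.vecMulVec Φ (star Φ)) =
      Matrix.vecMulVec Φ (star Φ) := rfl
  rw [LinearMap.comp_id, hid] at h
  rw [outState, h, Matrix.mul_vecMulVec, Matrix.vecMulVec_mul, localMul, Matrix.star_mulVec]

/-- `Λ ⊗ id` maps pure states to density matrices. -/
def IsStateMap (Λ : SuperOp d) : Prop :=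
  ∀ Φ : Fin d × Fin d → ℂ, star Φ ⬝ᵥ Φ = 1 →
    (outState Λ Φ).PosSemidef ∧ (outState Λ Φ).trace = 1

theorem isStateMap_unitaryChannel {U : Matrix (Fin d) (Fin d) ℂ}
    (hU : U ∈ Matrix.unitaryGroup (Fin d) ℂ) : IsStateMap (unitaryChannel U) := by
  intro Φ hΦ
  rw [outState_unitaryChannel]
  refine ⟨Matrix.posSemidef_vecMulVec_self_star _, ?_⟩
  rw [Matrix.trace_vecMulVec, dotProduct_comm, star_localMul_dotProduct_self hU, hΦ]

theorem isStateMap_id : IsStateMap (LinearMap.id : SuperOp d) := by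
  rw [← unitaryChannel_one]
  exact isStateMap_unitaryChannel (one_mem _)

theorem convex_isStateMap : Convex ℝ {Λ : SuperOp d | IsStateMap Λ} := by
  intro A hA B hB a b ha hb hab Φ hΦ
  rw [outState_add, outState_smul, outState_smul]
  refine ⟨((hA Φ hΦ).1.smul ha).add ((hB Φ hΦ).1.smul hb), ?_⟩
  rw [Matrix.trace_add, Matrix.trace_smul, Matrix.trace_smul, (hA Φ hΦ).2, (hB Φ hΦ).2, ← add_smul,
    hab, one_smul]

theorem IsStateMap.comp {U : Matrix (Fin d) (Fin d) ℂ}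
    (hU : U ∈ Matrix.unitaryGroup (Fin d) ℂ) {A : SuperOp d} (hA : IsStateMap A) :
    IsStateMap (unitaryChannel U ∘ₗ A) := by
  intro Φ hΦ
  rw [outState, tensorId_unitaryChannel_comp]
  refine ⟨(hA Φ hΦ).1.mul_mul_conjTranspose_same _, ?_⟩
  rw [Matrix.trace_mul_comm, ← mul_assoc, Matrix.conjTranspose_kronecker,
    ← Matrix.mul_kronecker_mul, ← Matrix.star_eq_conjTranspose,
    Matrix.mem_unitaryGroup_iff'.1 hU]
  simpa [outState] using (hA Φ hΦ).2

theorem isHermitian_outState_sub {A B : SuperOp d} (hA : IsStateMap A) (hB : IsStateMap B)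
    {Φ : Fin d × Fin d → ℂ} (hΦ : star Φ ⬝ᵥ Φ = 1) :
    (outState A Φ - outState B Φ).IsHermitian ∧ (outState A Φ - outState B Φ).trace = 0 :=
  ⟨(hA Φ hΦ).1.isHermitian.sub (hB Φ hΦ).1.isHermitian,
    by rw [Matrix.trace_sub, (hA Φ hΦ).2, (hB Φ hΦ).2, sub_self]⟩

/-- Writing `M = C†C`, the trace of `F M` is that of the positive matrix `C F C†`; this is applied
to `E` and to `1 - E`. -/
theorem isEffect_re_trace_mul {n : Type*} [Fintype n] [DecidableEq n] {E M : Matrix n n ℂ}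
    (hE : IsEffect E) (hM : M.PosSemidef) :
    0 ≤ (E * M).trace.re ∧ (E * M).trace.re ≤ M.trace.re := by
  have key : ∀ F : Matrix n n ℂ, F.PosSemidef → 0 ≤ (F * M).trace.re := by
    intro F hF
    obtain ⟨C, rfl⟩ := CStarAlgebra.nonneg_iff_eq_star_mul_self.1 hM.nonneg
    rw [Matrix.star_eq_conjTranspose]
    rw [← mul_assoc, Matrix.trace_mul_comm, ← mul_assoc]
    exact (Complex.le_def.1 (hF.mul_mul_conjTranspose_same C).trace_nonneg).1
  refine ⟨key E hE.1, ?_⟩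
  have := key _ hE.2
  rw [sub_mul, one_mul, Matrix.trace_sub, Complex.sub_re] at this
  linarith

theorem trDist_outState_sub_le_one {A B : SuperOp d} (hA : IsStateMap A) (hB : IsStateMap B)
    {Φ : Fin d × Fin d → ℂ} (hΦ : star Φ ⬝ᵥ Φ = 1) :
    trDist (outState A Φ - outState B Φ) ≤ 1 := by
  obtain ⟨h1, h2⟩ := isHermitian_outState_sub hA hB hΦ
  obtain ⟨E, hE, h⟩ := exists_isEffect_trDist_eq h1 h2
  rw [h, mul_sub, Matrix.trace_sub, Complex.sub_re]
  have a := (isEffect_re_trace_mul hE (hA Φ hΦ).1).2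
  have b := (isEffect_re_trace_mul hE (hB Φ hΦ).1).1
  rw [(hA Φ hΦ).2, Complex.one_re] at a
  linarith

theorem diamondDist_eq (A B : SuperOp d) :
    diamondDist A B = sSup {t : ℝ | ∃ Φ : Fin d × Fin d → ℂ, star Φ ⬝ᵥ Φ = 1 ∧
      t = trDist (outState A Φ - outState B Φ)} := by
  unfold diamondDist outState
  simp only [tensorId_sub]

theorem trDist_le_diamondDist {A B : SuperOp d} (hA : IsStateMap A) (hB : IsStateMap B)
    {Φ : Fin d × Fin d → ℂ} (hΦ : star Φ ⬝ᵥ Φ = 1) :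
    trDist (outState A Φ - outState B Φ) ≤ diamondDist A B := by
  rw [diamondDist_eq]
  refine le_csSup ⟨1, ?_⟩ ⟨Φ, hΦ, rfl⟩
  rintro t ⟨Ψ, hΨ, rfl⟩
  exact trDist_outState_sub_le_one hA hB hΨ

theorem re_trace_le_diamondDist {A B : SuperOp d} (hA : IsStateMap A) (hB : IsStateMap B)
    {Φ : Fin d × Fin d → ℂ} (hΦ : star Φ ⬝ᵥ Φ = 1)
    {E : Matrix (Fin d × Fin d) (Fin d × Fin d) ℂ} (hE : IsEffect E) :
    (E * (outState A Φ - outState B Φ)).trace.re ≤ diamondDist A B := by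
  obtain ⟨h1, h2⟩ := isHermitian_outState_sub hA hB hΦ
  exact (re_trace_mul_le_trDist h1 h2 hE).trans (trDist_le_diamondDist hA hB hΦ)

/-- Testing by effects replaces the trace norm by linear functionals, which makes the triangle
inequality and convexity immediate. The condition `0 ≤ t` covers `d = 0`, where there is no unit
vector and the supremum is `0`. -/
theorem diamondDist_le {A B : SuperOp d} (hA : IsStateMap A) (hB : IsStateMap B) {t : ℝ}
    (ht : 0 ≤ t)
    (h : ∀ Φ : Fin d × Fin d → ℂ, star Φ ⬝ᵥ Φ = 1 →
      ∀ E, IsEffect E → (E * (outState A Φ - outState B Φ)).trace.re ≤ t) :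
    diamondDist A B ≤ t := by
  rw [diamondDist_eq]
  refine Real.sSup_le ?_ ht
  rintro _ ⟨Φ, hΦ, rfl⟩
  obtain ⟨h1, h2⟩ := isHermitian_outState_sub hA hB hΦ
  obtain ⟨E, hE, h'⟩ := exists_isEffect_trDist_eq h1 h2
  rw [h']
  exact h Φ hΦ E hE

theorem diamondDist_nonneg {A B : SuperOp d} (hA : IsStateMap A) (hB : IsStateMap B) :
    0 ≤ diamondDist A B := by
  rw [diamondDist_eq]
  refine Real.sSup_nonneg ?_
  rintro _ ⟨Φ, hΦ, rfl⟩
  obtain ⟨h1, h2⟩ := isHermitian_outState_sub hA hB hΦ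
  have := re_trace_mul_le_trDist (E := 0) h1 h2
    ⟨Matrix.PosSemidef.zero, by rw [sub_zero]; exact Matrix.PosSemidef.one⟩
  simpa using this

theorem diamondDist_triangle {A B C : SuperOp d} (hA : IsStateMap A) (hB : IsStateMap B)
    (hC : IsStateMap C) : diamondDist A C ≤ diamondDist A B + diamondDist B C := by
  refine diamondDist_le hA hC (add_nonneg (diamondDist_nonneg hA hB) (diamondDist_nonneg hB hC))
    fun Φ hΦ E hE => ?_
  have h1 := re_trace_le_diamondDist hA hB hΦ hE
  have h2 := re_trace_le_diamondDist hB hC hΦ hE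
  have h3 : outState A Φ - outState C Φ =
      (outState A Φ - outState B Φ) + (outState B Φ - outState C Φ) := by abel
  rw [h3, mul_add, Matrix.trace_add, Complex.add_re]
  exact add_le_add h1 h2

theorem diamondDist_convex {A A' B B' : SuperOp d} (hA : IsStateMap A) (hA' : IsStateMap A')
    (hB : IsStateMap B) (hB' : IsStateMap B') {a b t : ℝ} (ha : 0 ≤ a) (hb : 0 ≤ b)
    (hab : a + b = 1) (h : diamondDist A B ≤ t) (h' : diamondDist A' B' ≤ t) :
    diamondDist (a • A + b • A') (a • B + b • B') ≤ t := by
  refine diamondDist_le (convex_isStateMap hA hA' ha hb hab) (convex_isStateMap hB hB' ha hb hab)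
    ((diamondDist_nonneg hA hB).trans h) fun Φ hΦ E hE => ?_
  have h1 := (re_trace_le_diamondDist hA hB hΦ hE).trans h
  have h2 := (re_trace_le_diamondDist hA' hB' hΦ hE).trans h'
  have h3 : outState (a • A + b • A') Φ - outState (a • B + b • B') Φ =
      a • (outState A Φ - outState B Φ) + b • (outState A' Φ - outState B' Φ) := by
    simp only [outState_add, outState_smul, smul_sub]; abel
  rw [h3, mul_add, Matrix.trace_add, Complex.add_re, mul_smul_comm, mul_smul_comm,
    Matrix.trace_smul, Matrix.trace_smul, Complex.smul_re, Complex.smul_re, smul_eq_mul,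
    smul_eq_mul]
  calc _ ≤ a * t + b * t := by gcongr
    _ = t := by rw [← add_mul, hab, one_mul]

/-- The unitary is moved from the channels to the effect: `E` becomes the effect `K†EK`. -/
theorem diamondDist_comp_le {U : Matrix (Fin d) (Fin d) ℂ}
    (hU : U ∈ Matrix.unitaryGroup (Fin d) ℂ) {A B : SuperOp d} (hA : IsStateMap A)
    (hB : IsStateMap B) :
    diamondDist (unitaryChannel U ∘ₗ A) (unitaryChannel U ∘ₗ B) ≤ diamondDist A B := by
  refine diamondDist_le (hA.comp hU) (hB.comp hU) (diamondDist_nonneg hA hB) fun Φ hΦ E hE => ?_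
  set K := U ⊗ₖ (1 : Matrix (Fin d) (Fin d) ℂ) with hK
  have hKK : Kᴴ * K = 1 := by
    rw [hK, Matrix.conjTranspose_kronecker, ← Matrix.mul_kronecker_mul,
      ← Matrix.star_eq_conjTranspose, Matrix.mem_unitaryGroup_iff'.1 hU]
    simp
  have hE' : IsEffect (Kᴴ * E * K) := by
    refine ⟨hE.1.conjTranspose_mul_mul_same K, ?_⟩
    have := hE.2.conjTranspose_mul_mul_same K
    rwa [mul_sub, sub_mul, mul_one, hKK] at this
  have h := re_trace_le_diamondDist hA hB hΦ hE'
  rw [outState, outState, tensorId_unitaryChannel_comp, tensorId_unitaryChannel_comp, ← hK,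
    ← sub_mul, ← mul_sub]
  have h2 : (E * (K * (outState A Φ - outState B Φ) * Kᴴ)).trace =
      (Kᴴ * E * K * (outState A Φ - outState B Φ)).trace := by
    rw [← mul_assoc, Matrix.trace_mul_comm]
    simp only [mul_assoc]
  exact (congrArg Complex.re h2).trans_le h

theorem diamondDist_comp {U : Matrix (Fin d) (Fin d) ℂ}
    (hU : U ∈ Matrix.unitaryGroup (Fin d) ℂ) {A B : SuperOp d} (hA : IsStateMap A)
    (hB : IsStateMap B) :
    diamondDist (unitaryChannel U ∘ₗ A) (unitaryChannel U ∘ₗ B) = diamondDist A B := by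
  refine le_antisymm (diamondDist_comp_le hU hA hB) ?_
  have hinv : ∀ A : SuperOp d, unitaryChannel Uᴴ ∘ₗ (unitaryChannel U ∘ₗ A) = A := by
    intro A
    rw [← LinearMap.comp_assoc, ← unitaryChannel_mul, ← Matrix.star_eq_conjTranspose,
      Matrix.mem_unitaryGroup_iff'.1 hU, unitaryChannel_one, LinearMap.id_comp]
  have hU' : Uᴴ ∈ Matrix.unitaryGroup (Fin d) ℂ := Unitary.star_mem hU
  have h := diamondDist_comp_le hU' (hA.comp hU) (hB.comp hU)
  rwa [hinv, hinv] at h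

theorem le_diamondDist_unitaryChannel {U V : Matrix (Fin d) (Fin d) ℂ}
    (hU : U ∈ Matrix.unitaryGroup (Fin d) ℂ) (hV : V ∈ Matrix.unitaryGroup (Fin d) ℂ)
    {Φ : Fin d × Fin d → ℂ} (hΦ : star Φ ⬝ᵥ Φ = 1) {t : ℝ}
    (h : ‖star Φ ⬝ᵥ localMul (Uᴴ * V) Φ‖ ^ 2 ≤ 1 - t ^ 2) :
    t ≤ diamondDist (unitaryChannel U) (unitaryChannel V) := by
  refine le_trans ?_ (trDist_le_diamondDist (isStateMap_unitaryChannel hU)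
    (isStateMap_unitaryChannel hV) hΦ)
  rw [outState_unitaryChannel, outState_unitaryChannel, trDist_pure
    (by rw [star_localMul_dotProduct_self hU, hΦ]) (by rw [star_localMul_dotProduct_self hV, hΦ]),
    star_localMul_dotProduct]
  exact Real.le_sqrt_of_sq_le (by linarith)

theorem diamondDist_unitaryChannel_le {U V : Matrix (Fin d) (Fin d) ℂ}
    (hU : U ∈ Matrix.unitaryGroup (Fin d) ℂ) (hV : V ∈ Matrix.unitaryGroup (Fin d) ℂ)
    {t : ℝ} (ht : 0 ≤ t)
    (h : ∀ Φ : Fin d × Fin d → ℂ, star Φ ⬝ᵥ Φ = 1 →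
      1 - t ^ 2 ≤ ‖star Φ ⬝ᵥ localMul (Uᴴ * V) Φ‖ ^ 2) :
    diamondDist (unitaryChannel U) (unitaryChannel V) ≤ t := by
  rw [diamondDist_eq]
  refine Real.sSup_le ?_ ht
  rintro _ ⟨Φ, hΦ, rfl⟩
  rw [outState_unitaryChannel, outState_unitaryChannel, trDist_pure
    (by rw [star_localMul_dotProduct_self hU, hΦ]) (by rw [star_localMul_dotProduct_self hV, hΦ]),
    star_localMul_dotProduct]
  exact Real.sqrt_le_iff.2 ⟨ht, by linarith [h Φ hΦ]⟩

end DiamondDistance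

/-! ### Probabilistic errors: Jensen bound and single-state tests -/

section Errors

variable {d : ℕ}

theorem trace_mul_vecMulVec_star {n : Type*} [Fintype n] (E : Matrix n n ℂ) (φ : n → ℂ) :
    (E * Matrix.vecMulVec φ (star φ)).trace = star φ ⬝ᵥ (E *ᵥ φ) := by
  rw [Matrix.mul_vecMulVec, Matrix.trace_vecMulVec, dotProduct_comm]

theorem isEffect_vecMulVec_star {n : Type*} [Fintype n] [DecidableEq n] {ψ : n → ℂ}
    (hψ : star ψ ⬝ᵥ ψ = 1) : IsEffect (Matrix.vecMulVec ψ (star ψ)) := by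
  refine ⟨Matrix.posSemidef_vecMulVec_self_star ψ, ?_⟩
  set P := Matrix.vecMulVec ψ (star ψ) with hP
  have hH : Pᴴ = P := (Matrix.posSemidef_vecMulVec_self_star ψ).isHermitian
  have hPP : P * P = P := by rw [hP, vecMulVec_star_mul_vecMulVec_star, hψ, one_smul]
  have h : (1 - P)ᴴ * (1 - P) = 1 - P := by
    rw [Matrix.conjTranspose_sub, Matrix.conjTranspose_one, hH, mul_sub, sub_mul, sub_mul, hPP]
    simp
  rw [← h]
  exact Matrix.posSemidef_conjTranspose_mul_self _

theorem localMul_smul (r : ℝ) (U : Matrix (Fin d) (Fin d) ℂ) (Φ : Fin d × Fin d → ℂ) :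
    localMul (r • U) Φ = r • localMul U Φ := by
  funext ⟨i, k⟩
  rw [Pi.smul_apply, localMul_apply, localMul_apply, Finset.smul_sum]
  simp [mul_assoc]

theorem localMul_sum {ι : Type*} (s : Finset ι) (p : ι → ℝ)
    (W : ι → Matrix (Fin d) (Fin d) ℂ) (Φ : Fin d × Fin d → ℂ) :
    localMul (∑ x ∈ s, p x • W x) Φ = ∑ x ∈ s, p x • localMul (W x) Φ := by
  funext ⟨i, k⟩
  rw [localMul_apply, Finset.sum_apply]
  simp only [Pi.smul_apply, localMul_apply, Matrix.sum_apply, Matrix.smul_apply, Finset.sum_mul,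
    Finset.smul_sum]
  rw [Finset.sum_comm]
  simp [mul_assoc]

/-- Jensen's inequality for the form of `E`: the gap between the two sides is the `E`-variance of
the vectors `φ x` about their mean `χ`. -/
theorem re_dotProduct_mulVec_sum_le {n ι : Type*} [Fintype n] [Fintype ι] {E : Matrix n n ℂ}
    (hE : E.PosSemidef) {p : ι → ℝ} (hp : ∀ x, 0 ≤ p x) (hp1 : ∑ x, p x = 1) (φ : ι → n → ℂ) :
    (star (∑ x, p x • φ x) ⬝ᵥ (E *ᵥ ∑ x, p x • φ x)).re ≤
      ∑ x, p x * (star (φ x) ⬝ᵥ (E *ᵥ φ x)).re := by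
  set χ := ∑ x, p x • φ x with hχ
  have h0 : 0 ≤ ∑ x, p x * (star (φ x - χ) ⬝ᵥ (E *ᵥ (φ x - χ))).re :=
    Finset.sum_nonneg fun x _ => mul_nonneg (hp x) (hE.re_dotProduct_nonneg _)
  have h1 : ∑ x, p x * (star (φ x) ⬝ᵥ (E *ᵥ χ)).re = (star χ ⬝ᵥ (E *ᵥ χ)).re := by
    conv_rhs => rw [hχ, star_sum, sum_dotProduct, Complex.re_sum, ← hχ]
    refine Finset.sum_congr rfl fun x _ => ?_
    rw [star_smul, smul_dotProduct, Complex.smul_re, smul_eq_mul, star_trivial (p x)]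
  have h2 : ∑ x, p x * (star χ ⬝ᵥ (E *ᵥ φ x)).re = (star χ ⬝ᵥ (E *ᵥ χ)).re := by
    conv_rhs => rw [hχ, Matrix.mulVec_sum, dotProduct_sum, Complex.re_sum, ← hχ]
    refine Finset.sum_congr rfl fun x _ => ?_
    rw [Matrix.mulVec_smul, dotProduct_smul, Complex.smul_re, smul_eq_mul]
  have h3 : ∑ x, p x * (star (φ x - χ) ⬝ᵥ (E *ᵥ (φ x - χ))).re =
      ∑ x, p x * (star (φ x) ⬝ᵥ (E *ᵥ φ x)).re - ∑ x, p x * (star (φ x) ⬝ᵥ (E *ᵥ χ)).re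
        - ∑ x, p x * (star χ ⬝ᵥ (E *ᵥ φ x)).re + (∑ x, p x) * (star χ ⬝ᵥ (E *ᵥ χ)).re := by
    rw [Finset.sum_mul, ← Finset.sum_sub_distrib, ← Finset.sum_sub_distrib,
      ← Finset.sum_add_distrib]
    refine Finset.sum_congr rfl fun x _ => ?_
    rw [star_sub, Matrix.mulVec_sub, sub_dotProduct, dotProduct_sub, dotProduct_sub]
    simp only [Complex.sub_re]
    ring
  rw [h3, h1, h2, hp1] at h0
  linarith

/-- If a mixture of unitaries is, as a matrix, `μ U`, then the corresponding mixture of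
unitary channels is within `1 - μ²` of the channel of `U`. -/
theorem diamondDist_mixture_le {ι : Type*} [Fintype ι] {U : Matrix (Fin d) (Fin d) ℂ}
    (hU : U ∈ Matrix.unitaryGroup (Fin d) ℂ) {W : ι → Matrix (Fin d) (Fin d) ℂ}
    (hW : ∀ x, W x ∈ Matrix.unitaryGroup (Fin d) ℂ) {p : ι → ℝ} (hp : ∀ x, 0 ≤ p x)
    (hp1 : ∑ x, p x = 1) {μ : ℝ} (hμ : μ ^ 2 ≤ 1) (h : ∑ x, p x • W x = μ • U) :
    diamondDist (unitaryChannel U) (∑ x, p x • unitaryChannel (W x)) ≤ 1 - μ ^ 2 := by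
  have hmix : IsStateMap (∑ x, p x • unitaryChannel (W x)) :=
    convex_isStateMap.sum_mem (fun x _ => hp x) hp1
      fun x _ => isStateMap_unitaryChannel (hW x)
  refine diamondDist_le (isStateMap_unitaryChannel hU) hmix (by linarith) fun Φ hΦ E hE => ?_
  -- The vectors `(W x ⊗ 1) Φ` average to `μ (U ⊗ 1) Φ`. With `q ≤ 1` the probability of `E` on the
  -- ideal output, the mixture has probability at least `μ² q`, so the difference is at most `(1 -
  -- μ²) q`.
  have hJ := re_dotProduct_mulVec_sum_le hE.1 hp hp1 fun x => localMul (W x) Φ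
  rw [← localMul_sum, h, localMul_smul, star_smul, star_trivial, Matrix.mulVec_smul,
    dotProduct_smul, smul_dotProduct, Complex.smul_re, Complex.smul_re, smul_eq_mul,
    smul_eq_mul] at hJ
  have h1 : (E * (outState (unitaryChannel U) Φ -
      outState (∑ x, p x • unitaryChannel (W x)) Φ)).trace.re =
      (star (localMul U Φ) ⬝ᵥ (E *ᵥ localMul U Φ)).re -
        ∑ x, p x * (star (localMul (W x) Φ) ⬝ᵥ (E *ᵥ localMul (W x) Φ)).re := by
    rw [outState_sum, mul_sub, Matrix.trace_sub, Complex.sub_re, outState_unitaryChannel,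
      trace_mul_vecMulVec_star, Finset.mul_sum, Matrix.trace_sum, Complex.re_sum]
    congr 1
    refine Finset.sum_congr rfl fun x _ => ?_
    rw [outState_unitaryChannel, mul_smul_comm, Matrix.trace_smul, trace_mul_vecMulVec_star,
      Complex.smul_re, smul_eq_mul]
  have h2 := (isEffect_re_trace_mul hE (isStateMap_unitaryChannel hU Φ hΦ).1).2
  rw [(isStateMap_unitaryChannel hU Φ hΦ).2, outState_unitaryChannel, trace_mul_vecMulVec_star,
    Complex.one_re] at h2
  rw [h1]
  nlinarith

theorem bddBelow_diamondDist {B : SuperOp d} (hB : IsStateMap B) {S : Set (SuperOp d)}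
    (hS : S ⊆ {Λ | IsStateMap Λ}) : BddBelow ((fun Γ => diamondDist B Γ) '' S) := by
  refine ⟨0, ?_⟩
  rintro _ ⟨Γ, hΓ, rfl⟩
  exact diamondDist_nonneg hB (hS hΓ)

theorem detError_le {B : SuperOp d} (hB : IsStateMap B) {S : Set (SuperOp d)}
    (hS : S ⊆ {Λ | IsStateMap Λ}) {Γ : SuperOp d} (hΓ : Γ ∈ S) :
    detError B S ≤ diamondDist B Γ :=
  csInf_le (bddBelow_diamondDist hB hS) ⟨Γ, hΓ, rfl⟩

/-- Nonemptiness matters because the real infimum of the empty set is `0`. -/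
theorem le_detError {B : SuperOp d} {S : Set (SuperOp d)} (hne : S.Nonempty) {t : ℝ}
    (h : ∀ Γ ∈ S, t ≤ diamondDist B Γ) : t ≤ detError B S := by
  refine le_csInf (hne.image _) ?_
  rintro _ ⟨Γ, hΓ, rfl⟩
  exact h Γ hΓ

theorem probError_eq_detError (B : SuperOp d) (S : Set (SuperOp d)) :
    probError B S = detError B (convexHull ℝ S) := rfl

theorem convexHull_subset_isStateMap {S : Set (SuperOp d)} (hS : S ⊆ {Λ | IsStateMap Λ}) :
    convexHull ℝ S ⊆ {Λ | IsStateMap Λ} :=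
  convexHull_min hS convex_isStateMap

theorem image_unitaryChannel_subset {A : Set (Matrix (Fin d) (Fin d) ℂ)}
    (hA : A ⊆ Matrix.unitaryGroup (Fin d) ℂ) : unitaryChannel '' A ⊆ {Λ | IsStateMap Λ} := by
  rintro _ ⟨W, hW, rfl⟩
  exact isStateMap_unitaryChannel (hA hW)

theorem detError_le_add {B C : SuperOp d} (hB : IsStateMap B) (hC : IsStateMap C)
    {S : Set (SuperOp d)} (hne : S.Nonempty) (hS : S ⊆ {Λ | IsStateMap Λ}) :
    detError B S ≤ diamondDist B C + detError C S := by
  rw [← sub_le_iff_le_add']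
  refine le_detError hne fun Γ hΓ => ?_
  rw [sub_le_iff_le_add']
  exact (detError_le hB hS hΓ).trans (diamondDist_triangle hB hC (hS hΓ))

theorem detError_comp {U : Matrix (Fin d) (Fin d) ℂ} (hU : U ∈ Matrix.unitaryGroup (Fin d) ℂ)
    {B : SuperOp d} (hB : IsStateMap B) {S : Set (SuperOp d)} (hS : S ⊆ {Λ | IsStateMap Λ}) :
    detError (unitaryChannel U ∘ₗ B) ((fun Γ => unitaryChannel U ∘ₗ Γ) '' S) = detError B S := by
  unfold detError
  rw [Set.image_image]
  congr 1
  exact Set.image_congr fun Γ hΓ => diamondDist_comp hU hB (hS hΓ)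

/-- Composition on the left is real linear, so it commutes with taking convex hulls. -/
theorem probError_comp {U : Matrix (Fin d) (Fin d) ℂ} (hU : U ∈ Matrix.unitaryGroup (Fin d) ℂ)
    {B : SuperOp d} (hB : IsStateMap B) {S : Set (SuperOp d)} (hS : S ⊆ {Λ | IsStateMap Λ}) :
    probError (unitaryChannel U ∘ₗ B) ((fun Γ => unitaryChannel U ∘ₗ Γ) '' S) =
      probError B S := by
  have h : IsLinearMap ℝ fun Γ : SuperOp d => unitaryChannel U ∘ₗ Γ :=
    ⟨fun _ _ => LinearMap.comp_add _ _ _, fun r Γ => by ext; simp⟩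
  rw [probError_eq_detError, probError_eq_detError, ← h.image_convexHull,
    detError_comp hU hB (convexHull_subset_isStateMap hS)]

/-- Testing with one input state and the ideal output gives a lower bound on the probabilistic
error. -/
theorem le_probError {U : Matrix (Fin d) (Fin d) ℂ} (hU : U ∈ Matrix.unitaryGroup (Fin d) ℂ)
    {A : Set (Matrix (Fin d) (Fin d) ℂ)} (hA : A ⊆ Matrix.unitaryGroup (Fin d) ℂ)
    (hne : A.Nonempty) {Φ : Fin d × Fin d → ℂ} (hΦ : star Φ ⬝ᵥ Φ = 1) {t : ℝ}
    (h : ∀ W ∈ A, ‖star Φ ⬝ᵥ localMul (Uᴴ * W) Φ‖ ^ 2 ≤ 1 - t) :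
    t ≤ probError (unitaryChannel U) (unitaryChannel '' A) := by
  have hψ : star (localMul U Φ) ⬝ᵥ localMul U Φ = 1 := by
    rw [star_localMul_dotProduct_self hU, hΦ]
  set E := Matrix.vecMulVec (localMul U Φ) (star (localMul U Φ)) with hE
  have key : ∀ W, (E * outState (unitaryChannel W) Φ).trace.re =
      ‖star Φ ⬝ᵥ localMul (Uᴴ * W) Φ‖ ^ 2 := by
    intro W
    have h1 : star (localMul W Φ) ⬝ᵥ localMul U Φ =
        star (star (localMul U Φ) ⬝ᵥ localMul W Φ) := Matrix.star_dotProduct _ _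
    rw [outState_unitaryChannel, hE, vecMulVec_star_mul_vecMulVec_star, Matrix.trace_smul,
      Matrix.trace_vecMulVec, dotProduct_comm (localMul U Φ), h1, star_localMul_dotProduct,
      smul_eq_mul, Complex.star_def, Complex.mul_conj, Complex.normSq_eq_norm_sq,
      Complex.ofReal_re]
  -- The probability of the ideal output is affine in the channel, so its sublevel set is convex and
  -- only the generators need checking.
  have hconv : convexHull ℝ (unitaryChannel '' A) ⊆
      {Λ | (E * outState Λ Φ).trace.re ≤ 1 - t} := by
    refine convexHull_min ?_ ?_
    · rintro _ ⟨W, hW, rfl⟩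
      change (E * outState (unitaryChannel W) Φ).trace.re ≤ 1 - t
      rw [key]
      exact h W hW
    · intro B hB C hC a b ha hb hab
      change (E * outState (a • B + b • C) Φ).trace.re ≤ 1 - t
      rw [outState_add, outState_smul, outState_smul, mul_add, Matrix.trace_add, Complex.add_re,
        mul_smul_comm, mul_smul_comm, Matrix.trace_smul, Matrix.trace_smul, Complex.smul_re,
        Complex.smul_re, smul_eq_mul, smul_eq_mul]
      calc _ ≤ a * (1 - t) + b * (1 - t) :=
            add_le_add (mul_le_mul_of_nonneg_left hB ha) (mul_le_mul_of_nonneg_left hC hb)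
        _ = 1 - t := by rw [← add_mul, hab, one_mul]
  have hS := image_unitaryChannel_subset hA
  refine le_detError (hne.image _).convexHull fun Λ hΛ => ?_
  refine le_trans ?_ (re_trace_le_diamondDist (isStateMap_unitaryChannel hU)
    (convexHull_subset_isStateMap hS hΛ) hΦ (isEffect_vecMulVec_star hψ))
  have h1 : (E * outState Λ Φ).trace.re ≤ 1 - t := hconv hΛ
  have h2 : (E * outState (unitaryChannel U) Φ).trace.re = 1 := by
    rw [outState_unitaryChannel, hE, vecMulVec_star_mul_vecMulVec_star, hψ, one_smul,
      Matrix.trace_vecMulVec, dotProduct_comm, hψ, Complex.one_re]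
  rw [mul_sub, Matrix.trace_sub, Complex.sub_re, h2]
  linarith

theorem probError_le_of_mixture {ι : Type*} [Fintype ι] {U : Matrix (Fin d) (Fin d) ℂ}
    (hU : U ∈ Matrix.unitaryGroup (Fin d) ℂ) {S : Set (SuperOp d)}
    (hS : S ⊆ {Λ | IsStateMap Λ}) {W : ι → Matrix (Fin d) (Fin d) ℂ}
    (hW : ∀ x, W x ∈ Matrix.unitaryGroup (Fin d) ℂ) (hWS : ∀ x, unitaryChannel (W x) ∈ S)
    {p : ι → ℝ} (hp : ∀ x, 0 ≤ p x) (hp1 : ∑ x, p x = 1) {μ : ℝ} (hμ : μ ^ 2 ≤ 1)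
    (h : ∑ x, p x • W x = μ • U) : probError (unitaryChannel U) S ≤ 1 - μ ^ 2 := by
  refine (detError_le (isStateMap_unitaryChannel hU) (convexHull_subset_isStateMap hS) ?_).trans
    (diamondDist_mixture_le hU hW hp hp1 hμ h)
  exact (convex_convexHull ℝ S).sum_mem (fun x _ => hp x) hp1
    fun x _ => subset_convexHull ℝ S (hWS x)

end Errors

/-! ### Compactness of the unitary group and finite approximating subsets -/

section FiniteNets

variable {d : ℕ}

theorem star_dotProduct_self_eq {n : Type*} [Fintype n] (v : n → ℂ) :
    star v ⬝ᵥ v = ((∑ i, ‖v i‖ ^ 2 : ℝ) : ℂ) := by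
  rw [dotProduct, Complex.ofReal_sum]
  refine Finset.sum_congr rfl fun i _ => ?_
  rw [Pi.star_apply, Complex.star_def, mul_comm, Complex.mul_conj, Complex.normSq_eq_norm_sq]

/-- The operator norm is at most the Frobenius norm, and tensoring with the identity does not change
this: Cauchy–Schwarz is applied to each row of `D`. -/
theorem sum_norm_localMul_sq_le (D : Matrix (Fin d) (Fin d) ℂ) {Φ : Fin d × Fin d → ℂ}
    (hΦ : star Φ ⬝ᵥ Φ = 1) :
    ∑ p, ‖localMul D Φ p‖ ^ 2 ≤ ∑ i, ∑ j, ‖D i j‖ ^ 2 := by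
  have h1 : ∑ k, ∑ j, ‖Φ (j, k)‖ ^ 2 = 1 := by
    rw [star_dotProduct_self_eq, Fintype.sum_prod_type, Finset.sum_comm] at hΦ
    exact_mod_cast hΦ
  rw [Fintype.sum_prod_type]
  refine Finset.sum_le_sum fun i _ => ?_
  calc ∑ k, ‖localMul D Φ (i, k)‖ ^ 2
      ≤ ∑ k, (∑ j, ‖D i j‖ ^ 2) * ∑ j, ‖Φ (j, k)‖ ^ 2 := by
        refine Finset.sum_le_sum fun k _ => ?_
        rw [localMul_apply]
        have h2 : ‖∑ j, D i j * Φ (j, k)‖ ≤ ∑ j, ‖D i j‖ * ‖Φ (j, k)‖ :=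
          (norm_sum_le _ _).trans_eq (Finset.sum_congr rfl fun j _ => norm_mul _ _)
        exact (pow_le_pow_left₀ (norm_nonneg _) h2 2).trans
          (Finset.sum_mul_sq_le_sq_mul_sq _ _ _)
    _ = ∑ j, ‖D i j‖ ^ 2 := by rw [← Finset.mul_sum, h1, mul_one]

/-- The output vectors satisfy `‖a - b‖² = 2 - 2 Re⟨a, b⟩ ≤ r²`, and `|⟨a, b⟩|² ≥ (Re⟨a, b⟩)² ≥ 2
Re⟨a, b⟩ - 1 ≥ 1 - r²`. -/
theorem diamondDist_unitaryChannel_le_of_sum_sq_le {U V : Matrix (Fin d) (Fin d) ℂ}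
    (hU : U ∈ Matrix.unitaryGroup (Fin d) ℂ) (hV : V ∈ Matrix.unitaryGroup (Fin d) ℂ) {r : ℝ}
    (hr : 0 ≤ r) (h : ∑ i, ∑ j, ‖U i j - V i j‖ ^ 2 ≤ r ^ 2) :
    diamondDist (unitaryChannel U) (unitaryChannel V) ≤ r := by
  refine diamondDist_unitaryChannel_le hU hV hr fun Φ hΦ => ?_
  rw [← star_localMul_dotProduct]
  set a := localMul U Φ with ha
  set b := localMul V Φ with hb
  have haa : star a ⬝ᵥ a = 1 := by rw [ha, star_localMul_dotProduct_self hU, hΦ]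
  have hbb : star b ⬝ᵥ b = 1 := by rw [hb, star_localMul_dotProduct_self hV, hΦ]
  have hD : localMul (U - V) Φ = a - b := by
    funext ⟨i, k⟩
    simp [ha, hb, localMul_apply, sub_mul]
  have h1 : (star (a - b) ⬝ᵥ (a - b)).re ≤ r ^ 2 := by
    rw [star_dotProduct_self_eq, Complex.ofReal_re, ← hD]
    exact (sum_norm_localMul_sq_le _ hΦ).trans h
  have hba : (star b ⬝ᵥ a).re = (star a ⬝ᵥ b).re := by
    have : star b ⬝ᵥ a = star (star a ⬝ᵥ b) := Matrix.star_dotProduct _ _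
    rw [this]; simp
  rw [star_sub, sub_dotProduct, dotProduct_sub, dotProduct_sub, haa, hbb] at h1
  simp only [Complex.sub_re, Complex.one_re, hba] at h1
  have h2 : (star a ⬝ᵥ b).re ^ 2 ≤ ‖star a ⬝ᵥ b‖ ^ 2 := by
    rw [← sq_abs]
    exact pow_le_pow_left₀ (abs_nonneg _) (Complex.abs_re_le_norm _) 2
  nlinarith [sq_nonneg ((star a ⬝ᵥ b).re - 1)]

/-- The matrix with the given entries. -/
def matrixOfEuclidean (x : EuclideanSpace ℂ (Fin d × Fin d)) : Matrix (Fin d) (Fin d) ℂ :=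
  Matrix.of fun i j => x (i, j)

theorem matrixOfEuclidean_surjective :
    Function.Surjective (matrixOfEuclidean (d := d)) := fun U =>
  ⟨WithLp.toLp 2 fun p => U p.1 p.2, rfl⟩

theorem diamondDist_matrixOfEuclidean_le {x y : EuclideanSpace ℂ (Fin d × Fin d)}
    (hx : matrixOfEuclidean x ∈ Matrix.unitaryGroup (Fin d) ℂ)
    (hy : matrixOfEuclidean y ∈ Matrix.unitaryGroup (Fin d) ℂ) :
    diamondDist (unitaryChannel (matrixOfEuclidean x)) (unitaryChannel (matrixOfEuclidean y)) ≤
      dist x y := by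
  refine diamondDist_unitaryChannel_le_of_sum_sq_le hx hy dist_nonneg ?_
  rw [EuclideanSpace.dist_eq, Real.sq_sqrt (by positivity), Fintype.sum_prod_type]
  simp [matrixOfEuclidean, dist_eq_norm]

theorem isCompact_unitary_preimage :
    IsCompact {x : EuclideanSpace ℂ (Fin d × Fin d) |
      matrixOfEuclidean x ∈ Matrix.unitaryGroup (Fin d) ℂ} := by
  refine Metric.isCompact_of_isClosed_isBounded ?_ ?_
  · have hc : Continuous (matrixOfEuclidean (d := d)) :=
      continuous_matrix fun i j => (EuclideanSpace.proj (i, j)).continuous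
    have hset : {x : EuclideanSpace ℂ (Fin d × Fin d) |
        matrixOfEuclidean x ∈ Matrix.unitaryGroup (Fin d) ℂ} =
        {x | matrixOfEuclidean x * (matrixOfEuclidean x)ᴴ = 1} := by
      ext x
      exact Matrix.mem_unitaryGroup_iff
    rw [hset]
    exact isClosed_eq (hc.matrix_mul hc.matrix_conjTranspose) continuous_const
  · refine (Metric.isBounded_closedBall (x := 0) (r := √(Fintype.card (Fin d × Fin d)))).subset
      fun x hx => ?_
    rw [mem_closedBall_zero_iff, EuclideanSpace.norm_eq]
    refine Real.sqrt_le_sqrt ?_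
    calc ∑ i, ‖x i‖ ^ 2 ≤ ∑ _i : Fin d × Fin d, (1 : ℝ) := by
          refine Finset.sum_le_sum fun p _ => pow_le_one₀ (norm_nonneg _) ?_
          exact entry_norm_bound_of_unitary hx p.1 p.2
      _ = _ := by simp

/-- `A` need not be closed: total boundedness is inherited from the compact unitary group and
already provides a net with centres in `A`. -/
theorem exists_finite_net {A : Set (Matrix (Fin d) (Fin d) ℂ)}
    (hA : A ⊆ Matrix.unitaryGroup (Fin d) ℂ) {r : ℝ} (hr : 0 < r) :
    ∃ T ⊆ A, T.Finite ∧
      ∀ W ∈ A, ∃ V ∈ T, diamondDist (unitaryChannel W) (unitaryChannel V) ≤ r := by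
  have htb : TotallyBounded (matrixOfEuclidean ⁻¹' A) :=
    isCompact_unitary_preimage.totallyBounded.subset fun x hx => hA hx
  obtain ⟨T, hT, hfin, hcov⟩ := Metric.finite_approx_of_totallyBounded htb r hr
  refine ⟨matrixOfEuclidean '' T, Set.image_subset_iff.2 hT, hfin.image _, fun W hW => ?_⟩
  obtain ⟨x, rfl⟩ := matrixOfEuclidean_surjective W
  obtain ⟨y, hy, hxy⟩ := Set.mem_iUnion₂.1 (hcov hW)
  exact ⟨_, ⟨y, hy, rfl⟩,
    (diamondDist_matrixOfEuclidean_le (hA hW) (hA (hT hy))).trans (Metric.mem_ball.1 hxy).le⟩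

/-- By the triangle inequality the error is 1-Lipschitz in the target, and the targets form a
compact set. Since `S` need not consist of unitary channels, this applies to convex hulls as well.
-/
theorem exists_isGreatest_detError {S : Set (SuperOp d)} (hne : S.Nonempty)
    (hS : S ⊆ {Λ | IsStateMap Λ}) :
    ∃ e, IsGreatest {t : ℝ | ∃ U ∈ Matrix.unitaryGroup (Fin d) ℂ,
      t = detError (unitaryChannel U) S} e := by
  set K := {x : EuclideanSpace ℂ (Fin d × Fin d) |
    matrixOfEuclidean x ∈ Matrix.unitaryGroup (Fin d) ℂ} with hK
  have hcont : ContinuousOn (fun x => detError (unitaryChannel (matrixOfEuclidean x)) S) K := by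
    refine (LipschitzOnWith.of_le_add fun x hx y hy => ?_).continuousOn
    have h := detError_le_add (isStateMap_unitaryChannel hx) (isStateMap_unitaryChannel hy) hne hS
    linarith [diamondDist_matrixOfEuclidean_le hx hy]
  obtain ⟨x₁, hx₁⟩ := matrixOfEuclidean_surjective (d := d) 1
  have hx₁K : x₁ ∈ K := by
    rw [hK, Set.mem_ofPred_eq, hx₁]
    exact one_mem _
  obtain ⟨x, hx, hmax⟩ := isCompact_unitary_preimage.exists_isMaxOn ⟨x₁, hx₁K⟩ hcont
  refine ⟨_, ⟨_, hx, rfl⟩, ?_⟩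
  rintro _ ⟨U, hU, rfl⟩
  obtain ⟨y, rfl⟩ := matrixOfEuclidean_surjective U
  exact hmax hU

/-- Joint convexity of the distance makes the set of state maps that are `r`-close to `convexHull ℝ
T` convex. -/
theorem exists_net_convexHull {S T : Set (SuperOp d)} (hS : S ⊆ {Λ | IsStateMap Λ})
    (hT : T ⊆ {Λ | IsStateMap Λ}) {r : ℝ} (h : ∀ B ∈ S, ∃ C ∈ T, diamondDist B C ≤ r) :
    ∀ B ∈ convexHull ℝ S, ∃ C ∈ convexHull ℝ T, diamondDist B C ≤ r := by
  have hsub : convexHull ℝ S ⊆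
      {B | IsStateMap B ∧ ∃ C ∈ convexHull ℝ T, diamondDist B C ≤ r} := by
    refine convexHull_min (fun B hB => ⟨hS hB, ?_⟩) ?_
    · obtain ⟨C, hC, hBC⟩ := h B hB
      exact ⟨C, subset_convexHull ℝ T hC, hBC⟩
    · rintro B ⟨hB, C, hC, hBC⟩ B' ⟨hB', C', hC', hBC'⟩ a b ha hb hab
      exact ⟨convex_isStateMap hB hB' ha hb hab, _, convex_convexHull ℝ T hC hC' ha hb hab,
        diamondDist_convex hB hB' (convexHull_subset_isStateMap hT hC)
          (convexHull_subset_isStateMap hT hC') ha hb hab hBC hBC'⟩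
  exact fun B hB => (hsub hB).2

theorem abs_detError_sub_le {S T : Set (SuperOp d)} (hS : S ⊆ {Λ | IsStateMap Λ}) (hTS : T ⊆ S)
    (hne : T.Nonempty) {r : ℝ} (h : ∀ B ∈ S, ∃ C ∈ T, diamondDist B C ≤ r) {B : SuperOp d}
    (hB : IsStateMap B) : |detError B T - detError B S| ≤ r := by
  have h1 : detError B S ≤ detError B T := le_detError hne fun Γ hΓ => detError_le hB hS (hTS hΓ)
  have h2 : detError B T - r ≤ detError B S := by
    refine le_detError (hne.mono hTS) fun Γ hΓ => ?_
    obtain ⟨C, hC, hΓC⟩ := h Γ hΓ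
    have := (detError_le hB (hTS.trans hS) hC).trans
      (diamondDist_triangle hB (hS hΓ) (hS (hTS hC)))
    linarith
  have h3 : 0 ≤ r := by
    obtain ⟨Γ, hΓ⟩ := hne
    obtain ⟨C, hC, hΓC⟩ := h Γ (hTS hΓ)
    exact (diamondDist_nonneg (hS (hTS hΓ)) (hS (hTS hC))).trans hΓC
  rw [abs_le]
  constructor <;> linarith

theorem abs_sub_le_of_isGreatest {X : Type*} {K : Set X} {f g : X → ℝ} {a b r : ℝ}
    (h : ∀ x ∈ K, |f x - g x| ≤ r) (ha : IsGreatest {t | ∃ x ∈ K, t = f x} a)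
    (hb : IsGreatest {t | ∃ x ∈ K, t = g x} b) : |a - b| ≤ r := by
  obtain ⟨⟨x, hx, rfl⟩, ha'⟩ := ha
  obtain ⟨⟨y, hy, rfl⟩, hb'⟩ := hb
  have h1 := abs_le.1 (h x hx)
  have h2 := abs_le.1 (h y hy)
  have h3 := ha' ⟨y, hy, rfl⟩
  have h4 := hb' ⟨x, hx, rfl⟩
  rw [abs_le]
  constructor <;> linarith

/-- A set of unitary channels contains finite subsets whose errors, both for single targets and
in the worst case, are arbitrarily close to those of the set. -/
theorem exists_finset_errors {A : Set (Matrix (Fin d) (Fin d) ℂ)}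
    (hA : A ⊆ Matrix.unitaryGroup (Fin d) ℂ) (hne : A.Nonempty) {r : ℝ} (hr : 0 < r) :
    ∃ S : Finset (SuperOp d), S.Nonempty ∧ (S : Set (SuperOp d)) ⊆ unitaryChannel '' A ∧
      (∀ B, IsStateMap B →
        |detError B (S : Set (SuperOp d)) - detError B (unitaryChannel '' A)| ≤ r ∧
        |probError B (S : Set (SuperOp d)) - probError B (unitaryChannel '' A)| ≤ r) ∧
      (∀ e₀, IsWorstDetError (unitaryChannel '' A) e₀ →
        ∃ e, IsWorstDetError (S : Set (SuperOp d)) e ∧ |e - e₀| ≤ r) ∧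
      ∀ v₀, IsWorstProbError (unitaryChannel '' A) v₀ →
        ∃ v, IsWorstProbError (S : Set (SuperOp d)) v ∧ |v - v₀| ≤ r := by
  obtain ⟨T, hTA, hfin, hnet⟩ := exists_finite_net hA hr
  obtain ⟨S, hS⟩ := (hfin.image unitaryChannel).exists_finset_coe
  have hTne : T.Nonempty := by
    obtain ⟨W, hW⟩ := hne
    obtain ⟨V, hV, _⟩ := hnet W hW
    exact ⟨V, hV⟩
  have hAs := image_unitaryChannel_subset hA
  have hsub : (S : Set (SuperOp d)) ⊆ unitaryChannel '' A := hS ▸ Set.image_mono hTA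
  have hSne : (S : Set (SuperOp d)).Nonempty := hS ▸ hTne.image _
  have hnet' : ∀ B ∈ unitaryChannel '' A, ∃ C ∈ (S : Set (SuperOp d)), diamondDist B C ≤ r := by
    rintro _ ⟨W, hW, rfl⟩
    obtain ⟨V, hV, hWV⟩ := hnet W hW
    exact ⟨unitaryChannel V, hS ▸ ⟨V, hV, rfl⟩, hWV⟩
  have hSs := hsub.trans hAs
  have hdet : ∀ B, IsStateMap B →
      |detError B (S : Set (SuperOp d)) - detError B (unitaryChannel '' A)| ≤ r :=
    fun B hB => abs_detError_sub_le hAs hsub hSne hnet' hB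
  have hprob : ∀ B, IsStateMap B →
      |probError B (S : Set (SuperOp d)) - probError B (unitaryChannel '' A)| ≤ r :=
    fun B hB => abs_detError_sub_le (convexHull_subset_isStateMap hAs) (convexHull_mono hsub)
      hSne.convexHull (exists_net_convexHull hAs hSs hnet') hB
  refine ⟨S, Finset.coe_nonempty.1 hSne, hsub, fun B hB => ⟨hdet B hB, hprob B hB⟩, ?_, ?_⟩
  · intro e₀ he₀
    obtain ⟨e, he⟩ := exists_isGreatest_detError hSne hSs
    exact ⟨e, he, abs_sub_le_of_isGreatest
      (fun U hU => hdet _ (isStateMap_unitaryChannel hU)) he he₀⟩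
  · intro v₀ hv₀
    obtain ⟨v, hv⟩ := exists_isGreatest_detError hSne.convexHull (convexHull_subset_isStateMap hSs)
    exact ⟨v, hv, abs_sub_le_of_isGreatest
      (fun U hU => hprob _ (isStateMap_unitaryChannel hU)) hv hv₀⟩

/-- If the errors of a set of unitary channels are `ε` and `f ε` with `f` continuous, then finite
subsets come arbitrarily close to satisfying the same relation. -/
theorem exists_finset_errors_relation {A : Set (Matrix (Fin d) (Fin d) ℂ)}
    (hA : A ⊆ Matrix.unitaryGroup (Fin d) ℂ) (hne : A.Nonempty) {f : ℝ → ℝ} (hf : Continuous f)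
    (ε : ℝ) {η : ℝ} (hη : 0 < η) :
    ∃ S : Finset (SuperOp d), S.Nonempty ∧ (S : Set (SuperOp d)) ⊆ unitaryChannel '' A ∧
      (∀ B, IsStateMap B → detError B (unitaryChannel '' A) = ε →
        probError B (unitaryChannel '' A) = f ε →
        |detError B (S : Set (SuperOp d)) - ε| ≤ η ∧
        |probError B (S : Set (SuperOp d)) - f (detError B (S : Set (SuperOp d)))| ≤ η) ∧
      (IsWorstDetError (unitaryChannel '' A) ε → IsWorstProbError (unitaryChannel '' A) (f ε) →
        ∃ e v, IsWorstDetError (S : Set (SuperOp d)) e ∧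
          IsWorstProbError (S : Set (SuperOp d)) v ∧ |e - ε| ≤ η ∧ |v - f e| ≤ η) := by
  obtain ⟨δ, hδ, hfδ⟩ := Metric.continuous_iff.1 hf ε (η / 2) (half_pos hη)
  -- One `η / 2` pays for the change of the probabilistic error, the other for the change of `f`
  -- under the change of the deterministic error.
  have hr : 0 < min (δ / 2) (η / 2) := lt_min (half_pos hδ) (half_pos hη)
  have key : ∀ x y, |x - ε| ≤ min (δ / 2) (η / 2) → |y - f ε| ≤ min (δ / 2) (η / 2) →
      |x - ε| ≤ η ∧ |y - f x| ≤ η := by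
    intro x y hx hy
    have h1 : |f x - f ε| < η / 2 := by
      refine hfδ x ?_
      rw [Real.dist_eq]
      exact (hx.trans (min_le_left _ _)).trans_lt (half_lt_self hδ)
    refine ⟨(hx.trans (min_le_right _ _)).trans (half_le_self hη.le), ?_⟩
    calc |y - f x| = |(y - f ε) - (f x - f ε)| := by congr 1; ring
      _ ≤ |y - f ε| + |f x - f ε| := abs_sub _ _
      _ ≤ η / 2 + η / 2 := add_le_add (hy.trans (min_le_right _ _)) h1.le
      _ = η := add_halves η
  obtain ⟨S, hSne, hsub, herr, hdet, hprob⟩ := exists_finset_errors hA hne hr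
  refine ⟨S, hSne, hsub, fun B hB hd hp => ?_, fun hd hp => ?_⟩
  · obtain ⟨h1, h2⟩ := herr B hB
    rw [hd] at h1
    rw [hp] at h2
    exact key _ _ h1 h2
  · obtain ⟨e, he, h1⟩ := hdet _ hd
    obtain ⟨v, hv, h2⟩ := hprob _ hp
    exact ⟨e, v, he, hv, key _ _ h1 h2⟩

end FiniteNets

/-! ### Numerical range, trace and the hull of the eigenvalues -/

section EigenvalueHull

/-- Subtracting `2 q j` from each unit weight leaves nonnegative weights with sum `card ι - 2`; the
part removed is twice the small convex combination. -/
theorem norm_sum_le_of_le_half {ι : Type*} [Fintype ι] {u : ι → ℂ} (hu : ∀ j, ‖u j‖ = 1)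
    {q : ι → ℝ} (hq1 : ∑ j, q j = 1) {c : ℝ} (hc : ‖∑ j, q j • u j‖ ≤ c)
    (hq : ∀ j, q j ≤ 1 / 2) : ‖∑ j, u j‖ ≤ Fintype.card ι - 2 + 2 * c := by
  have h1 : ∑ j, u j = ∑ j, (1 - 2 * q j) • u j + (2 : ℝ) • ∑ j, q j • u j := by
    rw [Finset.smul_sum, ← Finset.sum_add_distrib]
    refine Finset.sum_congr rfl fun j _ => ?_
    rw [smul_smul, ← add_smul, sub_add_cancel, one_smul]
  have h2 : ‖∑ j, (1 - 2 * q j) • u j‖ ≤ ∑ j, (1 - 2 * q j) := by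
    refine (norm_sum_le _ _).trans_eq (Finset.sum_congr rfl fun j _ => ?_)
    rw [norm_smul, hu, mul_one, Real.norm_of_nonneg (by linarith [hq j])]
  rw [Finset.sum_sub_distrib, ← Finset.mul_sum, hq1, Finset.sum_const, Finset.card_univ,
    nsmul_eq_mul] at h2
  rw [h1]
  refine (norm_add_le _ _).trans ?_
  rw [norm_smul, Real.norm_of_nonneg zero_le_two]
  linarith

/-- The difference of the squared norms is `(t - 1/2)(|u|² - |v|²) + (t - 1/2)² |u - v|²`: moving
from the midpoint towards the longer vector does not decrease the norm. -/
theorem norm_midpoint_le {u v : ℂ} (hu : ‖u‖ = 1) (hv : ‖v‖ ≤ 1) {t : ℝ} (ht : 1 / 2 ≤ t) :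
    ‖u + v‖ / 2 ≤ ‖t • u + (1 - t) • v‖ := by
  have hre : ∀ w : ℂ, ‖w‖ ^ 2 = w.re ^ 2 + w.im ^ 2 := fun w => by
    rw [← Complex.normSq_eq_norm_sq, Complex.normSq_apply]; ring
  have h1 : u.re ^ 2 + u.im ^ 2 = 1 := by rw [← hre, hu, one_pow]
  have h2 : v.re ^ 2 + v.im ^ 2 ≤ 1 := by
    rw [← hre]; exact pow_le_one₀ (norm_nonneg _) hv
  refine (pow_le_pow_iff_left₀ (by positivity) (norm_nonneg _) two_ne_zero).1 ?_
  rw [div_pow, hre, hre]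
  simp only [Complex.add_re, Complex.add_im, Complex.smul_re, Complex.smul_im, smul_eq_mul]
  have h3 : (t * u.re + (1 - t) * v.re) ^ 2 + (t * u.im + (1 - t) * v.im) ^ 2 -
      ((u.re + v.re) ^ 2 + (u.im + v.im) ^ 2) / 2 ^ 2 =
      (t - 1 / 2) * ((u.re ^ 2 + u.im ^ 2) - (v.re ^ 2 + v.im ^ 2)) +
        (t - 1 / 2) ^ 2 * ((u.re - v.re) ^ 2 + (u.im - v.im) ^ 2) := by ring
  have h4 : 0 ≤ (t - 1 / 2) * ((u.re ^ 2 + u.im ^ 2) - (v.re ^ 2 + v.im ^ 2)) :=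
    mul_nonneg (by linarith) (by linarith)
  nlinarith [mul_nonneg (sq_nonneg (t - 1 / 2))
    (add_nonneg (sq_nonneg (u.re - v.re)) (sq_nonneg (u.im - v.im)))]

/-- Here `1 - 2 q k` may be negative, so the other points are first averaged to `v`. The small point
lies on the segment from `u k` to `v`, nearer to `u k`, hence `‖u k + v‖ ≤ 2c`. The remaining
weights `1 - q j / (1 - q k)` are nonnegative with sum `card ι - 2`. -/
theorem norm_sum_le_of_half_le {ι : Type*} [Fintype ι] [DecidableEq ι] {u : ι → ℂ}
    (hu : ∀ j, ‖u j‖ = 1) {q : ι → ℝ} (hq0 : ∀ j, 0 ≤ q j) (hq1 : ∑ j, q j = 1) {c : ℝ}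
    (hc : ‖∑ j, q j • u j‖ ≤ c) {k : ι} (hk : 1 / 2 ≤ q k) (hk1 : q k < 1) :
    ‖∑ j, u j‖ ≤ Fintype.card ι - 2 + 2 * c := by
  set s := Finset.univ.erase k with hs
  have hr : 0 < 1 - q k := by linarith
  have hsq : ∑ j ∈ s, q j = 1 - q k := by
    rw [← hq1, ← Finset.add_sum_erase _ _ (Finset.mem_univ k)]; ring
  set v : ℂ := ∑ j ∈ s, (q j / (1 - q k)) • u j with hv
  have hw : ∑ j ∈ s, q j / (1 - q k) = 1 := by rw [← Finset.sum_div, hsq, div_self hr.ne']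
  have hv1 : ‖v‖ ≤ 1 := by
    rw [← hw]
    refine (norm_sum_le _ _).trans_eq (Finset.sum_congr rfl fun j _ => ?_)
    rw [norm_smul, hu, mul_one, Real.norm_of_nonneg (div_nonneg (hq0 j) hr.le)]
  have hz : ∑ j, q j • u j = q k • u k + (1 - q k) • v := by
    rw [← Finset.add_sum_erase _ _ (Finset.mem_univ k), hv, Finset.smul_sum]
    congr 1
    refine Finset.sum_congr rfl fun j _ => ?_
    rw [smul_smul, mul_div_cancel₀ _ hr.ne']
  have h1 : ∑ j, u j = (u k + v) + ∑ j ∈ s, (1 - q j / (1 - q k)) • u j := by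
    rw [← Finset.add_sum_erase _ _ (Finset.mem_univ k), hv, add_assoc, ← Finset.sum_add_distrib]
    congr 1
    refine Finset.sum_congr rfl fun j _ => ?_
    rw [← add_smul, add_sub_cancel, one_smul]
  have h2 : ‖∑ j ∈ s, (1 - q j / (1 - q k)) • u j‖ ≤ ∑ j ∈ s, (1 - q j / (1 - q k)) := by
    refine (norm_sum_le _ _).trans_eq (Finset.sum_congr rfl fun j hj => ?_)
    have : q j ≤ 1 - q k := by
      rw [← hsq]
      exact Finset.single_le_sum (fun i _ => hq0 i) hj
    rw [norm_smul, hu, mul_one, Real.norm_of_nonneg (by rw [sub_nonneg, div_le_one hr]; exact this)]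
  have hcard : ((s.card : ℕ) : ℝ) = Fintype.card ι - 1 := by
    rw [hs, Finset.card_erase_of_mem (Finset.mem_univ k), Finset.card_univ,
      Nat.cast_pred (Fintype.card_pos_iff.2 ⟨k⟩)]
  rw [Finset.sum_sub_distrib, hw, Finset.sum_const, nsmul_eq_mul, mul_one, hcard] at h2
  have h3 := (norm_midpoint_le (hu k) hv1 hk).trans (hz ▸ hc)
  rw [h1]
  refine (norm_add_le _ _).trans ?_
  linarith

theorem norm_sum_le_of_norm_convexCombination_le {ι : Type*} [Fintype ι] {u : ι → ℂ}
    (hu : ∀ j, ‖u j‖ = 1) {q : ι → ℝ} (hq0 : ∀ j, 0 ≤ q j) (hq1 : ∑ j, q j = 1) {c : ℝ}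
    (hc : ‖∑ j, q j • u j‖ ≤ c) : ‖∑ j, u j‖ ≤ Fintype.card ι - 2 + 2 * c := by
  classical
  by_cases h : ∀ j, q j ≤ 1 / 2
  · exact norm_sum_le_of_le_half hu hq1 hc h
  push Not at h
  obtain ⟨k, hk⟩ := h
  rcases lt_or_ge (q k) 1 with hk1 | hk1
  · exact norm_sum_le_of_half_le hu hq0 hq1 hc hk.le hk1
  -- If `q k` is not below `1`, all other weights vanish. Then `c ≥ 1` and the triangle inequality
  -- is enough.
  have h0 : ∑ j ∈ Finset.univ.erase k, q j ≤ 0 := by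
    have := Finset.add_sum_erase Finset.univ q (Finset.mem_univ k)
    linarith
  have hz : ∑ j, q j • u j = q k • u k := by
    rw [← Finset.add_sum_erase _ _ (Finset.mem_univ k), Finset.sum_eq_zero, add_zero]
    intro j hj
    have : q j = 0 := le_antisymm
      ((Finset.single_le_sum (fun i _ => hq0 i) hj).trans h0) (hq0 j)
    rw [this, zero_smul]
  rw [hz, norm_smul, hu, mul_one, Real.norm_of_nonneg (hq0 k)] at hc
  have h1 : ‖∑ j, u j‖ ≤ Fintype.card ι := by
    refine (norm_sum_le _ _).trans_eq ?_
    simp [hu]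
  linarith

variable {d : ℕ}

theorem spectrum_conj_diagonal {Q : Matrix (Fin d) (Fin d) ℂ}
    (hQ : Q ∈ Matrix.unitaryGroup (Fin d) ℂ) (u : Fin d → ℂ) :
    spectrum ℂ (Q * Matrix.diagonal u * Qᴴ) = Set.range u := by
  have h := Unitary.spectrum_star_right_conjugate (R := ℂ) (a := Matrix.diagonal u)
    (U := (⟨Q, hQ⟩ : unitary (Matrix (Fin d) (Fin d) ℂ)))
  rw [spectrum_diagonal] at h
  exact h

theorem star_dotProduct_conj_diagonal_mulVec (Q : Matrix (Fin d) (Fin d) ℂ) (u x : Fin d → ℂ) :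
    star x ⬝ᵥ ((Q * Matrix.diagonal u * Qᴴ) *ᵥ x) = ∑ j, (‖(Qᴴ *ᵥ x) j‖ ^ 2) • u j := by
  have h := star_mulVec_dotProduct_mulVec Qᴴ (Matrix.diagonal u * Qᴴ) x x
  rw [Matrix.conjTranspose_conjTranspose, ← mul_assoc, ← Matrix.mulVec_mulVec] at h
  rw [← h, dotProduct]
  refine Finset.sum_congr rfl fun j _ => ?_
  rw [Matrix.mulVec_diagonal, Pi.star_apply, Complex.star_def, Complex.real_smul,
    ← Complex.normSq_eq_norm_sq, ← Complex.mul_conj]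
  ring

theorem mem_convexHull_range {ι : Type*} [Fintype ι] {u : ι → ℂ} {z : ℂ}
    (hz : z ∈ convexHull ℝ (Set.range u)) :
    ∃ q : ι → ℝ, (∀ j, 0 ≤ q j) ∧ ∑ j, q j = 1 ∧ z = ∑ j, q j • u j := by
  classical
  have hsub : convexHull ℝ (Set.range u) ⊆
      {z | ∃ q : ι → ℝ, (∀ j, 0 ≤ q j) ∧ ∑ j, q j = 1 ∧ z = ∑ j, q j • u j} := by
    refine convexHull_min ?_ ?_
    · rintro _ ⟨j, rfl⟩
      exact ⟨fun i => if i = j then 1 else 0, fun i => by positivity, by simp, by simp⟩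
    · rintro _ ⟨q, hq0, hq1, rfl⟩ _ ⟨q', hq0', hq1', rfl⟩ a b ha hb hab
      refine ⟨fun j => a * q j + b * q' j,
        fun j => add_nonneg (mul_nonneg ha (hq0 j)) (mul_nonneg hb (hq0' j)), ?_, ?_⟩
      · rw [Finset.sum_add_distrib, ← Finset.mul_sum, ← Finset.mul_sum, hq1, hq1', mul_one,
          mul_one, hab]
      · rw [Finset.smul_sum, Finset.smul_sum, ← Finset.sum_add_distrib]
        refine Finset.sum_congr rfl fun j _ => ?_
        rw [add_smul, mul_smul, mul_smul]
  exact hsub hz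

theorem star_mulVec_dotProduct_self {Q : Matrix (Fin d) (Fin d) ℂ}
    (hQ : Q ∈ Matrix.unitaryGroup (Fin d) ℂ) (x : Fin d → ℂ) :
    star (Q *ᵥ x) ⬝ᵥ (Q *ᵥ x) = star x ⬝ᵥ x := by
  rw [star_mulVec_dotProduct_mulVec, ← Matrix.star_eq_conjTranspose,
    Matrix.mem_unitaryGroup_iff'.1 hQ, Matrix.one_mulVec]

/-- In an eigenbasis, `⟨x, W x⟩` is the average of the eigenvalues with weights the squared moduli
of the coordinates of `x`. The converse, `exists_dotProduct_of_mem_hullUnitaries`, takes the roots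
`√(q j)` as coordinates. -/
theorem mem_hullUnitaries_of_dotProduct {ε : ℝ} {W : Matrix (Fin d) (Fin d) ℂ}
    (hW : W ∈ Matrix.unitaryGroup (Fin d) ℂ) {x : Fin d → ℂ} (hx : star x ⬝ᵥ x = 1)
    (h : ‖star x ⬝ᵥ (W *ᵥ x)‖ ≤ √(1 - ε ^ 2)) : W ∈ hullUnitaries d ε := by
  refine ⟨hW, _, ?_, h⟩
  obtain ⟨Q, hQ, u, hu, _, rfl⟩ := exists_unitary_diagonal hW
  rw [spectrum_conj_diagonal hQ, star_dotProduct_conj_diagonal_mulVec]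
  have hQ' : Qᴴ ∈ Matrix.unitaryGroup (Fin d) ℂ := Unitary.star_mem hQ
  rw [← star_mulVec_dotProduct_self hQ', star_dotProduct_self_eq] at hx
  exact (convex_convexHull ℝ _).sum_mem (fun j _ => by positivity) (by exact_mod_cast hx)
    fun j _ => subset_convexHull ℝ _ ⟨j, rfl⟩

theorem exists_dotProduct_of_mem_hullUnitaries {ε : ℝ} {W : Matrix (Fin d) (Fin d) ℂ}
    (hW : W ∈ hullUnitaries d ε) :
    ‖W.trace‖ ≤ d - 2 + 2 * √(1 - ε ^ 2) ∧
      ∃ x : Fin d → ℂ, star x ⬝ᵥ x = 1 ∧ ‖star x ⬝ᵥ (W *ᵥ x)‖ ≤ √(1 - ε ^ 2) := by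
  obtain ⟨hWu, z, hz, hzc⟩ := hW
  obtain ⟨Q, hQ, u, hu, _, rfl⟩ := exists_unitary_diagonal hWu
  rw [spectrum_conj_diagonal hQ] at hz
  obtain ⟨q, hq0, hq1, rfl⟩ := mem_convexHull_range hz
  have hQQ : Qᴴ * Q = 1 := Matrix.mem_unitaryGroup_iff'.1 hQ
  constructor
  · rw [trace_conj_diagonal hQQ]
    simpa using norm_sum_le_of_norm_convexCombination_le hu hq0 hq1 hzc
  · have hn : ∀ j, ‖((√(q j) : ℝ) : ℂ)‖ ^ 2 = q j := fun j => by
      rw [Complex.norm_real, Real.norm_eq_abs, sq_abs, Real.sq_sqrt (hq0 j)]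
    refine ⟨Q *ᵥ fun j => ((√(q j) : ℝ) : ℂ), ?_, ?_⟩
    · rw [star_mulVec_dotProduct_self hQ, star_dotProduct_self_eq]
      simp only [hn, hq1, Complex.ofReal_one]
    · rw [star_dotProduct_conj_diagonal_mulVec, Matrix.mulVec_mulVec, hQQ, Matrix.one_mulVec]
      simpa only [hn] using hzc

/-- The product vector of `x` and the `k`-th basis vector. -/
def productVec (x : Fin d → ℂ) (k : Fin d) : Fin d × Fin d → ℂ :=
  fun p => if p.2 = k then x p.1 else 0

/-- On product inputs the overlaps are the numerical range of `K`, which decides the deterministic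
error at the identity; on the maximally entangled input the overlap is the normalized trace, which
decides the probabilistic one. -/
theorem star_productVec_dotProduct_localMul (x : Fin d → ℂ) (k : Fin d)
    (K : Matrix (Fin d) (Fin d) ℂ) :
    star (productVec x k) ⬝ᵥ localMul K (productVec x k) = star x ⬝ᵥ (K *ᵥ x) := by
  rw [dotProduct, Fintype.sum_prod_type]
  simp only [localMul_apply]
  simp [productVec, dotProduct, Matrix.mulVec, apply_ite]

theorem star_productVec_dotProduct_self (x : Fin d → ℂ) (k : Fin d) :
    star (productVec x k) ⬝ᵥ productVec x k = star x ⬝ᵥ x := by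
  have h := star_productVec_dotProduct_localMul x k 1
  rwa [localMul_one, Matrix.one_mulVec] at h

/-- The maximally entangled vector. -/
noncomputable def maxEntangled (d : ℕ) : Fin d × Fin d → ℂ :=
  fun p => if p.1 = p.2 then ((√d)⁻¹ : ℝ) else 0

theorem star_maxEntangled_dotProduct_localMul (K : Matrix (Fin d) (Fin d) ℂ) :
    star (maxEntangled d) ⬝ᵥ localMul K (maxEntangled d) = K.trace / d := by
  have h : (((√d)⁻¹ : ℝ) : ℂ) * (((√d)⁻¹ : ℝ) : ℂ) = (d : ℂ)⁻¹ := by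
    rw [← Complex.ofReal_mul, ← mul_inv, Real.mul_self_sqrt (Nat.cast_nonneg d)]
    push_cast
    rfl
  rw [dotProduct, Fintype.sum_prod_type]
  simp only [localMul_apply, Pi.star_apply]
  simp only [maxEntangled, apply_ite star, star_zero, ite_mul, zero_mul, Finset.sum_ite_eq,
    Finset.mem_univ, if_true, mul_ite, mul_zero, Finset.sum_ite_eq', Complex.star_def,
    Complex.conj_ofReal]
  rw [Matrix.trace, div_eq_mul_inv, Finset.sum_mul]
  refine Finset.sum_congr rfl fun j _ => ?_
  rw [Matrix.diag_apply, ← h]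
  ring

theorem star_maxEntangled_dotProduct_self (hd : 0 < d) :
    star (maxEntangled d) ⬝ᵥ maxEntangled d = 1 := by
  have h := star_maxEntangled_dotProduct_localMul (1 : Matrix (Fin d) (Fin d) ℂ)
  rw [localMul_one] at h
  rw [h, Matrix.trace_one, Fintype.card_fin, div_self]
  exact_mod_cast hd.ne'

end EigenvalueHull

/-! ### The hull set: mixtures of plane rotations and the value of the lower bound -/

section LowerBound

variable {d : ℕ}

/-- Positivity survives tensoring with the identity, so a lower bound on the Hermitian part of `K`
also holds on entangled vectors. -/
theorem le_re_dotProduct_localMul {K : Matrix (Fin d) (Fin d) ℂ} {c : ℝ}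
    (h : (K + Kᴴ - ((2 * c : ℝ) : ℂ) • 1).PosSemidef) {Φ : Fin d × Fin d → ℂ}
    (hΦ : star Φ ⬝ᵥ Φ = 1) : c ≤ (star Φ ⬝ᵥ localMul K Φ).re := by
  have h1 := (h.kronecker (Matrix.PosSemidef.one (n := Fin d) (R := ℂ))).re_dotProduct_nonneg Φ
  change 0 ≤ (star Φ ⬝ᵥ localMul (K + Kᴴ - ((2 * c : ℝ) : ℂ) • 1) Φ).re at h1
  have h2 : localMul (K + Kᴴ - ((2 * c : ℝ) : ℂ) • 1) Φ =
      localMul K Φ + localMul Kᴴ Φ - ((2 * c : ℝ) : ℂ) • Φ := by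
    have h3 : localMul (((2 * c : ℝ) : ℂ) • 1) Φ = ((2 * c : ℝ) : ℂ) • Φ := by
      rw [localMul, Matrix.smul_kronecker, Matrix.smul_mulVec]
      exact congrArg _ (localMul_one Φ)
    rw [← h3]
    funext ⟨i, k⟩
    simp [localMul_apply, add_mul, sub_mul, Finset.sum_add_distrib]
  have h4 : (star Φ ⬝ᵥ localMul Kᴴ Φ).re = (star Φ ⬝ᵥ localMul K Φ).re := by
    have h5 := star_localMul_dotProduct K 1 Φ Φ
    rw [mul_one, localMul_one] at h5
    have h6 : star (localMul K Φ) ⬝ᵥ Φ = star (star Φ ⬝ᵥ localMul K Φ) :=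
      Matrix.star_dotProduct _ _
    rw [← h5, h6]
    simp
  rw [h2, dotProduct_sub, dotProduct_add, dotProduct_smul, hΦ, Complex.sub_re, Complex.add_re,
    h4, smul_eq_mul, mul_one, Complex.ofReal_re] at h1
  linarith

theorem diamondDist_le_of_posSemidef {U V : Matrix (Fin d) (Fin d) ℂ}
    (hU : U ∈ Matrix.unitaryGroup (Fin d) ℂ) (hV : V ∈ Matrix.unitaryGroup (Fin d) ℂ) {ε : ℝ}
    (hε0 : 0 ≤ ε) (hε1 : ε ≤ 1)
    (h : (Uᴴ * V + (Uᴴ * V)ᴴ - ((2 * √(1 - ε ^ 2) : ℝ) : ℂ) • 1).PosSemidef) :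
    diamondDist (unitaryChannel U) (unitaryChannel V) ≤ ε := by
  refine diamondDist_unitaryChannel_le hU hV hε0 fun Φ hΦ => ?_
  have h1 := (le_re_dotProduct_localMul h hΦ).trans (Complex.re_le_norm _)
  have h2 := pow_le_pow_left₀ (Real.sqrt_nonneg _) h1 2
  rwa [Real.sq_sqrt (by nlinarith)] at h2

/-- The rotation `1 - (1 - c) P + i s H` in the plane of the basis vectors `j` and `k`, with `P` the
projection onto the plane and `H` the exchange of the two vectors. -/
noncomputable def planeRotation (c s : ℝ) (j k : Fin d) : Matrix (Fin d) (Fin d) ℂ :=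
  1 - ((1 - c : ℝ) : ℂ) • (Matrix.single j j 1 + Matrix.single k k 1) +
    (Complex.I * (s : ℂ)) • (Matrix.single j k 1 + Matrix.single k j 1)

theorem planeRotation_conjTranspose (c s : ℝ) (j k : Fin d) :
    (planeRotation c s j k)ᴴ = planeRotation c (-s) j k := by
  simp only [planeRotation, Matrix.conjTranspose_add, Matrix.conjTranspose_sub,
    Matrix.conjTranspose_smul, Matrix.conjTranspose_one, Matrix.conjTranspose_single, star_one,
    Complex.star_def, map_mul, Complex.conj_I, Complex.conj_ofReal]
  rw [add_comm (Matrix.single k j (1 : ℂ))]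
  simp

theorem planeProj_mul_self {j k : Fin d} (hjk : j ≠ k) :
    (Matrix.single j j 1 + Matrix.single k k 1 : Matrix (Fin d) (Fin d) ℂ) *
      (Matrix.single j j 1 + Matrix.single k k 1) = Matrix.single j j 1 + Matrix.single k k 1 := by
  simp [add_mul, mul_add, Matrix.single_mul_single_of_ne, hjk, hjk.symm]

theorem planeRotation_mem_unitaryGroup {c s : ℝ} (hcs : c ^ 2 + s ^ 2 = 1) {j k : Fin d}
    (hjk : j ≠ k) : planeRotation c s j k ∈ Matrix.unitaryGroup (Fin d) ℂ := by
  rw [Matrix.mem_unitaryGroup_iff, Matrix.star_eq_conjTranspose, planeRotation_conjTranspose,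
    planeRotation, planeRotation]
  set P : Matrix (Fin d) (Fin d) ℂ := Matrix.single j j 1 + Matrix.single k k 1 with hP
  set H : Matrix (Fin d) (Fin d) ℂ := Matrix.single j k 1 + Matrix.single k j 1 with hH
  have hPP : P * P = P := planeProj_mul_self hjk
  have hPH : P * H = H := by
    simp [hP, hH, add_mul, mul_add, Matrix.single_mul_single_of_ne, hjk, hjk.symm]
  have hHP : H * P = H := by
    simp [hP, hH, add_mul, mul_add, Matrix.single_mul_single_of_ne, hjk, hjk.symm, add_comm]
  have hHH : H * H = P := by
    simp [hP, hH, add_mul, mul_add, Matrix.single_mul_single_of_ne, hjk, hjk.symm, add_comm]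
  have hcs' : (c : ℂ) ^ 2 + (s : ℂ) ^ 2 = 1 := by exact_mod_cast hcs
  simp only [add_mul, mul_add, sub_mul, mul_sub, smul_mul_assoc,
    mul_smul_comm, hPP, hPH, hHP, hHH, one_mul, mul_one]
  push_cast
  -- The product is `1` plus this multiple of `P`, and the coefficient equals `c² + s² - 1`.
  have hcoef : -(1 - (c : ℂ)) - (1 - c) * (1 - (1 - c)) -
      Complex.I * s * (Complex.I * s) = 0 := by
    linear_combination hcs' - (s : ℂ) ^ 2 * Complex.I_mul_I
  rw [← sub_eq_zero]
  refine Eq.trans ?_ ((congrArg (· • P) hcoef).trans (zero_smul ℂ P))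
  module

theorem planeRotation_apply_self (c s : ℝ) {j k : Fin d} (hjk : j ≠ k) :
    planeRotation c s j k j j = c := by
  simp [planeRotation, hjk.symm]

/-- The terms `± i s H` cancel and `2(1 - c)(1 - P)` remains, a nonnegative multiple of a
projection. -/
theorem posSemidef_planeRotation {c : ℝ} (hc : c ≤ 1) (s : ℝ) {j k : Fin d} (hjk : j ≠ k) :
    (planeRotation c s j k + (planeRotation c s j k)ᴴ - ((2 * c : ℝ) : ℂ) • 1).PosSemidef := by
  have hPP := planeProj_mul_self hjk
  rw [planeRotation_conjTranspose, planeRotation, planeRotation]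
  set P : Matrix (Fin d) (Fin d) ℂ := Matrix.single j j 1 + Matrix.single k k 1 with hP
  have hPH : Pᴴ = P := by simp [hP]
  have h : (1 - P)ᴴ * (1 - P) = 1 - P := by
    rw [Matrix.conjTranspose_sub, Matrix.conjTranspose_one, hPH, mul_sub, sub_mul, sub_mul, hPP]
    simp
  have h1 : (1 - P).PosSemidef := h ▸ Matrix.posSemidef_conjTranspose_mul_self _
  have h2 : (0 : ℂ) ≤ ((2 * (1 - c) : ℝ) : ℂ) := by
    exact_mod_cast mul_nonneg zero_le_two (sub_nonneg.2 hc)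
  have h3 := h1.smul h2
  convert h3 using 1
  push_cast
  module

/-- The two signs cancel the terms with `s`. As `σ` is a permutation, each basis vector occurs once
as `j` and once as `σ j`, so the projections add up to twice the identity. -/
theorem sum_planeRotation (hd : 2 ≤ d) (c s : ℝ) (σ : Fin d ≃ Fin d) :
    ∑ x : Fin d × Bool, ((2 * d : ℝ)⁻¹) •
      planeRotation c (if x.2 then s else -s) x.1 (σ x.1) = (1 - 2 * (1 - c) / d : ℝ) • 1 := by
  have hd0 : (d : ℂ) ≠ 0 := by
    exact_mod_cast (by omega : d ≠ 0)
  have h1 : ∑ j : Fin d, Matrix.single j j (1 : ℂ) = 1 := by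
    ext a b
    simp [Matrix.sum_apply, Matrix.single_apply, Matrix.one_apply, ite_and]
  have h2 : ∑ j : Fin d, Matrix.single (σ j) (σ j) (1 : ℂ) = 1 :=
    (Equiv.sum_comp σ fun j => Matrix.single j j (1 : ℂ)).trans h1
  have h3 : ∀ j : Fin d, ∑ b : Bool, planeRotation c (if b then s else -s) j (σ j) =
      (2 : ℂ) • 1 - ((2 * (1 - c) : ℝ) : ℂ) •
        (Matrix.single j j (1 : ℂ) + Matrix.single (σ j) (σ j) 1) := by
    intro j
    rw [Fintype.sum_bool, planeRotation, planeRotation]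
    simp only [if_true, Bool.false_eq_true, if_false]
    push_cast
    module
  rw [← Finset.smul_sum, Fintype.sum_prod_type]
  simp only [h3]
  rw [Finset.sum_sub_distrib, ← Finset.smul_sum (r := ((2 * (1 - c) : ℝ) : ℂ)),
    Finset.sum_add_distrib, h1, h2,
    Finset.sum_const, Finset.card_univ, Fintype.card_fin, ← Nat.cast_smul_eq_nsmul ℂ]
  ext a b
  by_cases hab : a = b
  · subst hab
    simp
    field_simp
    ring
  · simp [hab]

theorem exists_hullUnitaries_mixture (hd : 2 ≤ d) {ε : ℝ} (hε0 : 0 ≤ ε) (hε1 : ε ≤ 1)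
    {U : Matrix (Fin d) (Fin d) ℂ} (hU : U ∈ Matrix.unitaryGroup (Fin d) ℂ) :
    ∃ W : Fin d × Bool → Matrix (Fin d) (Fin d) ℂ,
      (∀ x, W x ∈ hullUnitaries d ε ∧
        diamondDist (unitaryChannel U) (unitaryChannel (W x)) ≤ ε) ∧
      ∑ x, ((2 * d : ℝ)⁻¹) • W x = (1 - 2 * (1 - √(1 - ε ^ 2)) / d : ℝ) • U := by
  obtain ⟨n, rfl⟩ : ∃ n, d = n + 2 := ⟨d - 2, by omega⟩
  set c := √(1 - ε ^ 2) with hc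
  have hc2 : c ^ 2 = 1 - ε ^ 2 := Real.sq_sqrt (by nlinarith)
  have hc0 : 0 ≤ c := Real.sqrt_nonneg _
  have hc1 : c ≤ 1 := by nlinarith
  obtain ⟨Q, hQ, u, hu, hUQ, -⟩ := exists_unitary_diagonal hU
  have hQQ : Qᴴ * Q = 1 := Matrix.mem_unitaryGroup_iff'.1 hQ
  have hQQ' : Q * Qᴴ = 1 := Matrix.mem_unitaryGroup_iff.1 hQ
  have hQ' : Qᴴ ∈ Matrix.unitaryGroup (Fin (n + 2)) ℂ := Unitary.star_mem hQ
  -- The cyclic shift has no fixed point because `1 ≠ 0` in `Fin (n + 2)`; this is where `2 ≤ d`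
  -- enters.
  set σ : Fin (n + 2) ≃ Fin (n + 2) := Equiv.addRight 1 with hσ
  have hne : ∀ j, j ≠ σ j := fun j h => one_ne_zero (left_eq_add.1 h)
  set T : Fin (n + 2) × Bool → Matrix (Fin (n + 2)) (Fin (n + 2)) ℂ :=
    fun x => planeRotation c (if x.2 then ε else -ε) x.1 (σ x.1) with hT
  have hTu : ∀ x, T x ∈ Matrix.unitaryGroup (Fin (n + 2)) ℂ := fun x =>
    planeRotation_mem_unitaryGroup (by split_ifs <;> rw [hc2] <;> ring) (hne x.1)
  have hWu : ∀ x, U * (Q * T x * Qᴴ) ∈ Matrix.unitaryGroup (Fin (n + 2)) ℂ := fun x =>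
    mul_mem hU (mul_mem (mul_mem hQ (hTu x)) hQ')
  refine ⟨fun x => U * (Q * T x * Qᴴ), fun x => ⟨?_, ?_⟩, ?_⟩
  -- The test vector is the eigenvector of `U` that spans the rotation plane with the next one; its
  -- expectation is the eigenvalue times the diagonal entry `c` of the rotation.
  · refine mem_hullUnitaries_of_dotProduct (hWu x) (x := Q *ᵥ Pi.single x.1 1) ?_ ?_
    · rw [star_mulVec_dotProduct_self hQ]
      simp
    · rw [Matrix.mulVec_mulVec, star_mulVec_dotProduct_mulVec]
      have h1 : Qᴴ * (U * (Q * T x * Qᴴ) * Q) = Matrix.diagonal u * T x := by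
        calc _ = Qᴴ * (U * Q) * T x * (Qᴴ * Q) := by simp only [mul_assoc]
          _ = _ := by rw [hUQ, hQQ, mul_one, ← mul_assoc, hQQ, one_mul]
      rw [h1]
      have h2 : star (Pi.single x.1 1 : Fin (n + 2) → ℂ) ⬝ᵥ
          ((Matrix.diagonal u * T x) *ᵥ Pi.single x.1 1) = u x.1 * c := by
        rw [← planeRotation_apply_self c (if x.2 then ε else -ε) (hne x.1)]
        simp [hT, Matrix.diagonal_mul]
      rw [h2, norm_mul, hu, one_mul, Complex.norm_real, Real.norm_of_nonneg hc0]
  -- Here `U†W = Q T Q†`, so the bound on the Hermitian part of the plane rotation is conjugated by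
  -- `Q`.
  · refine diamondDist_le_of_posSemidef hU (hWu x) hε0 hε1 ?_
    rw [← hc, ← mul_assoc, ← Matrix.star_eq_conjTranspose U, Matrix.mem_unitaryGroup_iff'.1 hU, one_mul]
    have h1 := (posSemidef_planeRotation hc1 (if x.2 then ε else -ε)
      (hne x.1)).mul_mul_conjTranspose_same Q
    convert h1 using 1
    simp only [hT, mul_add, add_mul, mul_sub, sub_mul, Matrix.conjTranspose_mul,
      Matrix.conjTranspose_conjTranspose, mul_smul_comm, smul_mul_assoc, mul_one, hQQ', mul_assoc]
  · have h1 := sum_planeRotation hd c ε σ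
    calc _ = U * (Q * (∑ x, ((2 * (n + 2 : ℕ) : ℝ)⁻¹) • T x) * Qᴴ) := by
          simp only [Finset.mul_sum, Finset.sum_mul, mul_smul_comm, smul_mul_assoc]
      _ = _ := by
          rw [h1]
          simp only [mul_smul_comm, smul_mul_assoc, mul_one, hQQ']

theorem hullUnitaries_subset (d : ℕ) (ε : ℝ) :
    hullUnitaries d ε ⊆ Matrix.unitaryGroup (Fin d) ℂ := fun _ h => h.1

theorem hullUnitaries_nonempty (hd : 2 ≤ d) {ε : ℝ} (hε0 : 0 ≤ ε) (hε1 : ε ≤ 1) :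
    (hullUnitaries d ε).Nonempty := by
  obtain ⟨W, hW, -⟩ := exists_hullUnitaries_mixture hd hε0 hε1 (one_mem _)
  exact ⟨_, (hW (⟨0, by omega⟩, true)).1⟩

/-- In this form both bounds meet: `1 - 2(1 - c)/d` is the scalar of the averaged rotations and also
the trace bound `(d - 2 + 2c)/d`. -/
theorem lowerBound_eq (d : ℕ) (ε : ℝ) :
    lowerBound d ε = 1 - (1 - 2 * (1 - √(1 - ε ^ 2)) / d) ^ 2 := by
  rw [lowerBound]
  ring

theorem continuous_lowerBound (d : ℕ) : Continuous (lowerBound d) := by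
  unfold lowerBound
  fun_prop

theorem detError_hullChannels_le (hd : 2 ≤ d) {ε : ℝ} (hε0 : 0 ≤ ε) (hε1 : ε ≤ 1)
    {U : Matrix (Fin d) (Fin d) ℂ} (hU : U ∈ Matrix.unitaryGroup (Fin d) ℂ) :
    detError (unitaryChannel U) (hullChannels d ε) ≤ ε := by
  obtain ⟨W, hW, -⟩ := exists_hullUnitaries_mixture hd hε0 hε1 hU
  obtain ⟨h1, h2⟩ := hW (⟨0, by omega⟩, true)
  exact (detError_le (isStateMap_unitaryChannel hU)
    (image_unitaryChannel_subset (hullUnitaries_subset d ε)) ⟨_, h1, rfl⟩).trans h2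

theorem probError_hullChannels_le (hd : 2 ≤ d) {ε : ℝ} (hε0 : 0 ≤ ε) (hε1 : ε ≤ 1)
    {U : Matrix (Fin d) (Fin d) ℂ} (hU : U ∈ Matrix.unitaryGroup (Fin d) ℂ) :
    probError (unitaryChannel U) (hullChannels d ε) ≤ lowerBound d ε := by
  obtain ⟨W, hW, hsum⟩ := exists_hullUnitaries_mixture hd hε0 hε1 hU
  rw [lowerBound_eq]
  have hd2 : (2 : ℝ) ≤ d := by exact_mod_cast hd
  have hc0 := Real.sqrt_nonneg (1 - ε ^ 2)
  have hc1 : √(1 - ε ^ 2) ≤ 1 := Real.sqrt_le_one.2 (by nlinarith)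
  have h1 : 2 * (1 - √(1 - ε ^ 2)) / d ≤ 1 := by
    rw [div_le_one (by linarith)]
    linarith
  have h2 : 0 ≤ 2 * (1 - √(1 - ε ^ 2)) / d := div_nonneg (by linarith) (by linarith)
  refine probError_le_of_mixture hU (image_unitaryChannel_subset (hullUnitaries_subset d ε))
    (fun x => (hW x).1.1) (fun x => ⟨_, (hW x).1, rfl⟩) (fun x => by positivity) ?_
    (pow_le_one₀ (by linarith) (by linarith)) hsum
  rw [Finset.sum_const, Finset.card_univ, Fintype.card_prod, Fintype.card_fin, Fintype.card_bool,
    nsmul_eq_mul]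
  push_cast
  field_simp

theorem le_detError_id_hullChannels (hd : 2 ≤ d) {ε : ℝ} (hε0 : 0 ≤ ε) (hε1 : ε ≤ 1) :
    ε ≤ detError LinearMap.id (hullChannels d ε) := by
  refine le_detError ((hullUnitaries_nonempty hd hε0 hε1).image _) ?_
  rintro _ ⟨W, hW, rfl⟩
  obtain ⟨-, x, hx, hxc⟩ := exists_dotProduct_of_mem_hullUnitaries hW
  rw [← unitaryChannel_one]
  refine le_diamondDist_unitaryChannel (one_mem _) hW.1 (Φ := productVec x ⟨0, by omega⟩) ?_ ?_
  · rw [star_productVec_dotProduct_self, hx]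
  · rw [Matrix.conjTranspose_one, one_mul, star_productVec_dotProduct_localMul]
    have h := pow_le_pow_left₀ (norm_nonneg _) hxc 2
    rwa [Real.sq_sqrt (by nlinarith)] at h

theorem le_probError_id_hullChannels (hd : 2 ≤ d) {ε : ℝ} (hε0 : 0 ≤ ε) (hε1 : ε ≤ 1) :
    lowerBound d ε ≤ probError LinearMap.id (hullChannels d ε) := by
  rw [← unitaryChannel_one]
  refine le_probError (one_mem _) (hullUnitaries_subset d ε)
    (hullUnitaries_nonempty hd hε0 hε1) (star_maxEntangled_dotProduct_self (by omega))
    fun W hW => ?_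
  obtain ⟨htr, -⟩ := exists_dotProduct_of_mem_hullUnitaries hW
  have hd0 : (0 : ℝ) < d := by exact_mod_cast (by omega : 0 < d)
  rw [Matrix.conjTranspose_one, one_mul, star_maxEntangled_dotProduct_localMul, lowerBound_eq,
    sub_sub_cancel, norm_div, Complex.norm_natCast]
  refine pow_le_pow_left₀ (by positivity) ?_ 2
  rw [div_le_iff₀ hd0, sub_mul, one_mul, div_mul_cancel₀ _ hd0.ne']
  linarith

theorem errors_id_hullChannels (hd : 2 ≤ d) {ε : ℝ} (hε0 : 0 ≤ ε) (hε1 : ε ≤ 1) :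
    detError LinearMap.id (hullChannels d ε) = ε ∧
      probError LinearMap.id (hullChannels d ε) = lowerBound d ε := by
  have h1 := detError_hullChannels_le hd hε0 hε1 (one_mem _)
  have h2 := probError_hullChannels_le hd hε0 hε1 (one_mem _)
  rw [unitaryChannel_one] at h1 h2
  exact ⟨h1.antisymm (le_detError_id_hullChannels hd hε0 hε1),
    h2.antisymm (le_probError_id_hullChannels hd hε0 hε1)⟩

theorem isWorst_hullChannels (hd : 2 ≤ d) {ε : ℝ} (hε0 : 0 ≤ ε) (hε1 : ε ≤ 1) :
    IsWorstDetError (hullChannels d ε) ε ∧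
      IsWorstProbError (hullChannels d ε) (lowerBound d ε) := by
  obtain ⟨h1, h2⟩ := errors_id_hullChannels hd hε0 hε1
  refine ⟨⟨⟨1, one_mem _, by rw [unitaryChannel_one, h1]⟩, ?_⟩,
    ⟨⟨1, one_mem _, by rw [unitaryChannel_one, h2]⟩, ?_⟩⟩
  · rintro _ ⟨U, hU, rfl⟩
    exact detError_hullChannels_le hd hε0 hε1 hU
  · rintro _ ⟨U, hU, rfl⟩
    exact probError_hullChannels_le hd hε0 hε1 hU

end LowerBound

/-! ### Block-diagonal unitaries and factorization through one rotation -/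

section BlockDiagonal

theorem blockDiag_mul {a b d : ℕ} (h : a + b = d) (A A' : Matrix (Fin a) (Fin a) ℂ)
    (B B' : Matrix (Fin b) (Fin b) ℂ) :
    blockDiag h (A * A') (B * B') = blockDiag h A B * blockDiag h A' B' := by
  simp only [blockDiag, Matrix.reindex_apply, Matrix.submatrix_mul_equiv,
    Matrix.fromBlocks_multiply, Matrix.mul_zero, Matrix.zero_mul, add_zero, zero_add]

theorem blockDiag_one {a b d : ℕ} (h : a + b = d) : blockDiag h 1 1 = 1 := by
  simp only [blockDiag, Matrix.reindex_apply, Matrix.fromBlocks_one, Matrix.submatrix_one_equiv]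

theorem blockDiag_conjTranspose {a b d : ℕ} (h : a + b = d) (A : Matrix (Fin a) (Fin a) ℂ)
    (B : Matrix (Fin b) (Fin b) ℂ) : (blockDiag h A B)ᴴ = blockDiag h Aᴴ Bᴴ := by
  simp [blockDiag, Matrix.reindex_apply, Matrix.conjTranspose_submatrix,
    Matrix.fromBlocks_conjTranspose]

theorem blockDiag_mem_unitaryGroup {a b d : ℕ} (h : a + b = d) {A : Matrix (Fin a) (Fin a) ℂ}
    {B : Matrix (Fin b) (Fin b) ℂ} (hA : A ∈ Matrix.unitaryGroup (Fin a) ℂ)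
    (hB : B ∈ Matrix.unitaryGroup (Fin b) ℂ) :
    blockDiag h A B ∈ Matrix.unitaryGroup (Fin d) ℂ := by
  rw [Matrix.mem_unitaryGroup_iff] at *
  rw [Matrix.star_eq_conjTranspose] at *
  rw [blockDiag_conjTranspose, ← blockDiag_mul, hA, hB, blockDiag_one]

theorem blockDiag_finCongr {a b d : ℕ} (h : a + b = d) (A : Matrix (Fin a) (Fin a) ℂ)
    (B : Matrix (Fin b) (Fin b) ℂ) (i j : Fin (a + b)) :
    blockDiag h A B (finCongr h i) (finCongr h j) =
      Matrix.fromBlocks A 0 0 B (finSumFinEquiv.symm i) (finSumFinEquiv.symm j) := by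
  subst h
  rfl

variable {n : ℕ}

theorem blockDiag_one_apply (h : 1 + (n + 1) = n + 2) (B : Matrix (Fin (n + 1)) (Fin (n + 1)) ℂ) :
    blockDiag h 1 B 0 0 = 1 ∧ (∀ j : Fin (n + 1), blockDiag h 1 B 0 j.succ = 0) ∧
      (∀ i : Fin (n + 1), blockDiag h 1 B i.succ 0 = 0) ∧
      ∀ i j : Fin (n + 1), blockDiag h 1 B i.succ j.succ = B i j := by
  have h0 : (0 : Fin (n + 2)) = finCongr h (Fin.castAdd (n + 1) 0) := by
    ext; simp
  have hs : ∀ i : Fin (n + 1), i.succ = finCongr h (Fin.natAdd 1 i) := by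
    intro i; ext; simp
  refine ⟨?_, fun j => ?_, fun i => ?_, fun i j => ?_⟩ <;>
    simp only [h0, hs, blockDiag_finCongr, finSumFinEquiv_symm_apply_castAdd,
      finSumFinEquiv_symm_apply_natAdd, Matrix.fromBlocks_apply₁₁, Matrix.fromBlocks_apply₁₂,
      Matrix.fromBlocks_apply₂₁, Matrix.fromBlocks_apply₂₂, Matrix.one_apply_eq,
      Matrix.zero_apply]

theorem blockDiag_two_apply_zero (h : 2 + n = n + 2) (A : Matrix (Fin 2) (Fin 2) ℂ) :
    blockDiag h A 1 0 0 = A 0 0 ∧ blockDiag h A 1 1 0 = A 1 0 ∧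
      ∀ i : Fin n, blockDiag h A 1 i.succ.succ 0 = 0 := by
  have h0 : (0 : Fin (n + 2)) = finCongr h (Fin.castAdd n 0) := by
    ext; simp
  have h1 : (1 : Fin (n + 2)) = finCongr h (Fin.castAdd n 1) := by
    ext; simp
  have hs : ∀ i : Fin n, i.succ.succ = finCongr h (Fin.natAdd 2 i) := by
    intro i; ext; simp
  refine ⟨?_, ?_, fun i => ?_⟩ <;>
    simp only [h0, h1, hs, blockDiag_finCongr, finSumFinEquiv_symm_apply_castAdd,
      finSumFinEquiv_symm_apply_natAdd, Matrix.fromBlocks_apply₁₁, Matrix.fromBlocks_apply₂₁,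
      Matrix.zero_apply]

theorem rotation_mem_unitaryGroup (θ : ℝ) :
    rotation θ ∈ Matrix.unitaryGroup (Fin 2) ℂ := by
  have h : (Real.cos θ : ℂ) * Real.cos θ + Real.sin θ * Real.sin θ = 1 := by
    exact_mod_cast (by nlinarith [Real.sin_sq_add_cos_sq θ] :
      Real.cos θ * Real.cos θ + Real.sin θ * Real.sin θ = 1)
  rw [Matrix.mem_unitaryGroup_iff]
  ext i j
  fin_cases i <;> fin_cases j <;>
    simp only [rotation, Matrix.star_eq_conjTranspose, Matrix.mul_apply, Fin.sum_univ_two,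
      Matrix.conjTranspose_apply, Fin.zero_eta, Fin.mk_one, Fin.isValue, Matrix.of_apply,
      Matrix.cons_val', Matrix.cons_val_zero, Matrix.cons_val_one, Matrix.cons_val_fin_one,
      Complex.star_def, map_neg, Complex.conj_ofReal, Matrix.one_apply_eq, Matrix.one_apply_ne,
      ne_eq, zero_ne_one, one_ne_zero, not_false_eq_true] <;>
    first | ring1 | linear_combination h

/-- The normalized `w` is completed to an orthonormal basis. For `s = 0` the vector `w` is zero and
any unitary serves. -/
theorem exists_unitary_col {n : ℕ} (w : Fin (n + 1) → ℂ) {s : ℝ} (hs : 0 ≤ s)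
    (hw : ∑ i, ‖w i‖ ^ 2 = s ^ 2) :
    ∃ V ∈ Matrix.unitaryGroup (Fin (n + 1)) ℂ, ∀ i, w i = s * V i 0 := by
  rcases hs.eq_or_lt with rfl | hs
  · refine ⟨1, one_mem _, fun i => ?_⟩
    have h0 : ‖w i‖ ^ 2 ≤ 0 := by
      have := Finset.single_le_sum (fun j _ => sq_nonneg ‖w j‖) (Finset.mem_univ i)
      rwa [hw, zero_pow two_ne_zero] at this
    have h1 : ‖w i‖ = 0 := pow_eq_zero_iff two_ne_zero |>.1 (h0.antisymm (sq_nonneg _))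
    rw [norm_eq_zero.1 h1, Complex.ofReal_zero, zero_mul]
  · have hs' : (s : ℂ) ≠ 0 := by exact_mod_cast hs.ne'
    set v : EuclideanSpace ℂ (Fin (n + 1)) := WithLp.toLp 2 fun i => (s : ℂ)⁻¹ * w i with hv
    have hv1 : ‖v‖ = 1 := by
      rw [EuclideanSpace.norm_eq, Real.sqrt_eq_one]
      simp only [hv, norm_mul, mul_pow]
      rw [← Finset.mul_sum, hw, norm_inv, Complex.norm_real, Real.norm_of_nonneg hs.le]
      field_simp
    obtain ⟨b, hb⟩ := Orthonormal.exists_orthonormalBasis_extension_of_card_eq (𝕜 := ℂ)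
      (E := EuclideanSpace ℂ (Fin (n + 1))) (ι := Fin (n + 1)) (by simp)
      (v := fun _ => v) (s := {0})
      ⟨fun _ => hv1, fun i j hij => (hij (Subsingleton.elim i j)).elim⟩
    refine ⟨_, matrixOf_orthonormalBasis_mem_unitaryGroup b, fun i => ?_⟩
    rw [Matrix.of_apply, hb 0 rfl, hv]
    simp only
    rw [mul_inv_cancel_left₀ hs']

theorem sum_norm_sq_col {d : ℕ} {V : Matrix (Fin d) (Fin d) ℂ}
    (hV : V ∈ Matrix.unitaryGroup (Fin d) ℂ) (j : Fin d) : ∑ i, ‖V i j‖ ^ 2 = 1 := by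
  have h := congrFun (congrFun (Matrix.mem_unitaryGroup_iff'.1 hV) j) j
  rw [Matrix.star_eq_conjTranspose, Matrix.mul_apply, Matrix.one_apply_eq] at h
  have h1 := star_dotProduct_self_eq fun i => V i j
  rw [dotProduct] at h1
  exact_mod_cast h1.symm.trans h

/-- If the first column is the first basis vector, orthonormality of the columns forces the same for
the first row, and the remaining block is unitary. -/
theorem exists_eq_blockDiag_one {M : Matrix (Fin (n + 2)) (Fin (n + 2)) ℂ}
    (hM : M ∈ Matrix.unitaryGroup (Fin (n + 2)) ℂ) (h0 : ∀ i, M i 0 = if i = 0 then 1 else 0)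
    (h : 1 + (n + 1) = n + 2) :
    ∃ B ∈ Matrix.unitaryGroup (Fin (n + 1)) ℂ, M = blockDiag h 1 B := by
  have hrow : ∀ j, M 0 j = if j = 0 then 1 else 0 := by
    intro j
    have h1 := congrFun (congrFun (Matrix.mem_unitaryGroup_iff'.1 hM) j) 0
    rw [Matrix.star_eq_conjTranspose, Matrix.mul_apply] at h1
    simp only [h0, mul_ite, mul_one, mul_zero, Finset.sum_ite_eq', Finset.mem_univ, if_true,
      Matrix.conjTranspose_apply, Matrix.one_apply] at h1
    have h2 := congrArg star h1
    rw [star_star] at h2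
    rw [h2]
    split_ifs <;> simp
  refine ⟨M.submatrix Fin.succ Fin.succ, ?_, ?_⟩
  · rw [Matrix.mem_unitaryGroup_iff]
    ext i j
    have h1 := congrFun (congrFun (Matrix.mem_unitaryGroup_iff.1 hM) i.succ) j.succ
    rw [Matrix.star_eq_conjTranspose, Matrix.mul_apply, Fin.sum_univ_succ, h0,
      if_neg (Fin.succ_ne_zero i), zero_mul, zero_add] at h1
    rw [Matrix.star_eq_conjTranspose, Matrix.mul_apply]
    simpa [Matrix.one_apply] using h1
  · obtain ⟨e1, e2, e3, e4⟩ := blockDiag_one_apply h (M.submatrix Fin.succ Fin.succ)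
    ext i j
    refine Fin.cases ?_ (fun i => ?_) i <;> refine Fin.cases ?_ (fun j => ?_) j
    · rw [e1, h0, if_pos rfl]
    · rw [e2, hrow, if_neg (Fin.succ_ne_zero j)]
    · rw [e3, h0, if_neg (Fin.succ_ne_zero i)]
    · rw [e4, Matrix.submatrix_apply]

/-- A unitary with real entry `cos θ` in the corner, `0 ≤ θ ≤ π`, is a product
`(1 ⊕ V₁) (R(θ) ⊕ 1) (1 ⊕ V₂)`. -/
theorem exists_eq_blockDiag_rotation {V : Matrix (Fin (n + 2)) (Fin (n + 2)) ℂ}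
    (hV : V ∈ Matrix.unitaryGroup (Fin (n + 2)) ℂ) {θ : ℝ} (h0 : 0 ≤ θ) (hπ : θ ≤ Real.pi)
    (h : V 0 0 = Real.cos θ) (h1 : 1 + (n + 1) = n + 2) (h2 : 2 + n = n + 2) :
    ∃ V₁ ∈ Matrix.unitaryGroup (Fin (n + 1)) ℂ, ∃ V₂ ∈ Matrix.unitaryGroup (Fin (n + 1)) ℂ,
      V = blockDiag h1 1 V₁ * blockDiag h2 (rotation θ) 1 * blockDiag h1 1 V₂ := by
  have hcol := sum_norm_sq_col hV 0
  rw [Fin.sum_univ_succ, h, Complex.norm_real, Real.norm_eq_abs, sq_abs] at hcol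
  obtain ⟨V₁, hV₁, hw⟩ := exists_unitary_col (fun i : Fin (n + 1) => V i.succ 0)
    (Real.sin_nonneg_of_nonneg_of_le_pi h0 hπ) (by linarith [Real.sin_sq_add_cos_sq θ])
  -- `V₁` is chosen so that `N` and `V` have the same first column; then `N†V` fixes the first basis
  -- vector and has the form `1 ⊕ V₂`.
  set N := blockDiag h1 1 V₁ * blockDiag h2 (rotation θ) 1 with hN
  have hNu : N ∈ Matrix.unitaryGroup (Fin (n + 2)) ℂ :=
    mul_mem (blockDiag_mem_unitaryGroup h1 (one_mem _) hV₁)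
      (blockDiag_mem_unitaryGroup h2 (rotation_mem_unitaryGroup θ) (one_mem _))
  have hNcol : ∀ i, N i 0 = V i 0 := by
    obtain ⟨e1, e2, e3, e4⟩ := blockDiag_one_apply h1 V₁
    obtain ⟨f1, f2, f3⟩ := blockDiag_two_apply_zero h2 (rotation θ)
    have hsum : ∀ i, N i 0 = blockDiag h1 1 V₁ i 0 * Real.cos θ +
        blockDiag h1 1 V₁ i 1 * Real.sin θ := by
      intro i
      rw [hN, Matrix.mul_apply, Fin.sum_univ_succ, Fin.sum_univ_succ, f1, Fin.succ_zero_eq_one, f2,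
        Finset.sum_eq_zero fun j _ => by rw [f3, mul_zero], add_zero]
      simp [rotation]
    intro i
    rw [hsum]
    refine Fin.cases ?_ (fun i => ?_) i
    · rw [e1, ← Fin.succ_zero_eq_one, e2, h]
      ring
    · rw [e3, ← Fin.succ_zero_eq_one, e4, hw]
      ring
  have hNN : N * Nᴴ = 1 := Matrix.mem_unitaryGroup_iff.1 hNu
  have hNN' : Nᴴ * N = 1 := Matrix.mem_unitaryGroup_iff'.1 hNu
  have hNs : Nᴴ ∈ Matrix.unitaryGroup (Fin (n + 2)) ℂ := Unitary.star_mem hNu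
  obtain ⟨V₂, hV₂, hM⟩ := exists_eq_blockDiag_one (mul_mem hNs hV) (fun i => by
    rw [Matrix.mul_apply]
    simp only [← hNcol]
    rw [← Matrix.mul_apply, hNN', Matrix.one_apply]) h1
  exact ⟨V₁, hV₁, V₂, hV₂, by rw [← hM, ← mul_assoc, hNN, one_mul]⟩

end BlockDiagonal

/-! ### The rotation set: corner entries, reflections and the value of the upper bound -/

section UpperBound

variable {n : ℕ}

theorem rotationUnitaries_corner {ε : ℝ} (hε0 : 0 ≤ ε) (hε1 : ε ≤ 1) (hd : 2 ≤ n + 2)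
    {V : Matrix (Fin (n + 2)) (Fin (n + 2)) ℂ} (hV : V ∈ rotationUnitaries (n + 2) hd ε) :
    V ∈ Matrix.unitaryGroup (Fin (n + 2)) ℂ ∧ ε ≤ ‖V 0 0‖ := by
  obtain ⟨V₁, hV₁, V₂, hV₂, θ, hθ0, hθ, rfl⟩ := hV
  have h1 : 1 + (n + 1) = n + 2 := by omega
  have h2 : 2 + n = n + 2 := by omega
  change blockDiag h1 1 V₁ * blockDiag h2 (rotation θ) 1 * blockDiag h1 1 V₂ ∈ _ ∧
    ε ≤ ‖(blockDiag h1 1 V₁ * blockDiag h2 (rotation θ) 1 * blockDiag h1 1 V₂) 0 0‖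
  refine ⟨mul_mem (mul_mem (blockDiag_mem_unitaryGroup h1 (one_mem _) hV₁)
    (blockDiag_mem_unitaryGroup h2 (rotation_mem_unitaryGroup θ) (one_mem _)))
    (blockDiag_mem_unitaryGroup h1 (one_mem _) hV₂), ?_⟩
  obtain ⟨e1, e2, -, -⟩ := blockDiag_one_apply h1 V₁
  obtain ⟨g1, -, g3, -⟩ := blockDiag_one_apply h1 V₂
  obtain ⟨f1, -, -⟩ := blockDiag_two_apply_zero h2 (rotation θ)
  have h3 : (blockDiag h1 1 V₁ * blockDiag h2 (rotation θ) 1 * blockDiag h1 1 V₂) 0 0 =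
      Real.cos θ := by
    rw [Matrix.mul_apply, Fin.sum_univ_succ, g1, Finset.sum_eq_zero fun j _ => by rw [g3, mul_zero],
      Matrix.mul_apply, Fin.sum_univ_succ, e1, f1,
      Finset.sum_eq_zero fun j _ => by rw [e2, zero_mul]]
    simp [rotation]
  rw [h3, Complex.norm_real, ← Real.cos_arccos (by linarith) hε1]
  exact (Real.cos_le_cos_of_nonneg_of_le_pi hθ0 (Real.arccos_le_pi ε) hθ).trans (le_abs_self _)

theorem exists_norm_eq_one_mul_eq_norm (w : ℂ) : ∃ z : ℂ, ‖z‖ = 1 ∧ z * w = ‖w‖ := by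
  rcases eq_or_ne w 0 with rfl | hw
  · exact ⟨1, norm_one, by simp⟩
  · have hn : (‖w‖ : ℂ) ≠ 0 := by exact_mod_cast norm_ne_zero_iff.2 hw
    refine ⟨‖w‖ / w, ?_, div_mul_cancel₀ _ hw⟩
    rw [norm_div, Complex.norm_real, norm_norm, div_self (norm_ne_zero_iff.2 hw)]

theorem smul_mem_unitaryGroup {d : ℕ} {z : ℂ} (hz : ‖z‖ = 1) {U : Matrix (Fin d) (Fin d) ℂ}
    (hU : U ∈ Matrix.unitaryGroup (Fin d) ℂ) : z • U ∈ Matrix.unitaryGroup (Fin d) ℂ := by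
  have h : z * star z = 1 := by
    rw [Complex.star_def, Complex.mul_conj, Complex.normSq_eq_norm_sq, hz]; norm_num
  rw [Matrix.mem_unitaryGroup_iff] at *
  rw [star_smul, smul_mul_smul_comm, hU, h, one_smul]

/-- A global phase makes the corner entry real and nonnegative without changing the channel, and the
factorization applies with `θ = arccos ‖V 0 0‖`. Together with `rotationUnitaries_corner` this
describes the set by the size of the corner entry alone. -/
theorem unitaryChannel_mem_rotationChannels {ε : ℝ} (hd : 2 ≤ n + 2)
    {V : Matrix (Fin (n + 2)) (Fin (n + 2)) ℂ} (hV : V ∈ Matrix.unitaryGroup (Fin (n + 2)) ℂ)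
    (h : ε ≤ ‖V 0 0‖) : unitaryChannel V ∈ rotationChannels (n + 2) hd ε := by
  obtain ⟨z, hz, hzV⟩ := exists_norm_eq_one_mul_eq_norm (V 0 0)
  have hc : Real.cos (Real.arccos ‖V 0 0‖) = ‖V 0 0‖ :=
    Real.cos_arccos (by linarith [norm_nonneg (V 0 0)]) (entry_norm_bound_of_unitary hV 0 0)
  obtain ⟨V₁, hV₁, V₂, hV₂, hVV⟩ := exists_eq_blockDiag_rotation (smul_mem_unitaryGroup hz hV)
    (Real.arccos_nonneg ‖V 0 0‖) (Real.arccos_le_pi _)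
    (by rw [Matrix.smul_apply, smul_eq_mul, hzV, hc]) (by omega) (by omega)
  exact ⟨z • V, ⟨V₁, hV₁, V₂, hV₂, _, Real.arccos_nonneg _, Real.arccos_le_arccos h, hVV⟩,
    unitaryChannel_smul hz V⟩

/-- A Householder reflection that completes the first row of `U`. -/
theorem exists_reflection {U : Matrix (Fin (n + 2)) (Fin (n + 2)) ℂ}
    (hU : U ∈ Matrix.unitaryGroup (Fin (n + 2)) ℂ) {r : ℝ} (hr : U 0 0 = r) :
    ∃ H : Matrix (Fin (n + 2)) (Fin (n + 2)) ℂ, Hᴴ = H ∧ H * H = 1 ∧ (U * H) 0 0 = 1 := by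
  set e : Fin (n + 2) → ℂ := Pi.single 0 1 with he
  set w := Uᴴ *ᵥ e - e with hw
  have hU' : Uᴴ ∈ Matrix.unitaryGroup (Fin (n + 2)) ℂ := Unitary.star_mem hU
  have hee : star e ⬝ᵥ e = 1 := by simp [he]
  have hUe : (Uᴴ *ᵥ e) 0 = r := by simp [he, hr]
  have h1 : star e ⬝ᵥ (Uᴴ *ᵥ e) = r := by
    rw [he, ← Pi.single_star, star_one, single_one_dotProduct, ← he, hUe]
  have h2 : star (Uᴴ *ᵥ e) ⬝ᵥ e = r := by
    have : star (Uᴴ *ᵥ e) ⬝ᵥ e = star (star e ⬝ᵥ (Uᴴ *ᵥ e)) := Matrix.star_dotProduct _ _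
    rw [this, h1, Complex.star_def, Complex.conj_ofReal]
  have hww : star w ⬝ᵥ w = 2 * (1 - r) := by
    rw [hw, star_sub, sub_dotProduct, dotProduct_sub, dotProduct_sub, hee, h1, h2,
      star_mulVec_dotProduct_self hU', hee]
    ring
  have hw0 : w 0 = r - 1 := by
    rw [hw, Pi.sub_apply, hUe, he, Pi.single_eq_same]
  have hUw : (U *ᵥ w) 0 = 1 - r := by
    have hUU : U * Uᴴ = 1 := Matrix.mem_unitaryGroup_iff.1 hU
    rw [hw, Matrix.mulVec_sub, Matrix.mulVec_mulVec, hUU, Matrix.one_mulVec, Pi.sub_apply]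
    simp [he, hr]
  set P := Matrix.vecMulVec w (star w) with hP
  have hPH : Pᴴ = P := (Matrix.posSemidef_vecMulVec_self_star w).isHermitian
  have hPP : P * P = (2 * (1 - r) : ℂ) • P := by
    rw [hP, vecMulVec_star_mul_vecMulVec_star, hww]
  -- Since `w†w = 2(1 - r)`, this is the reflection exchanging `e` and `U†e`, so `U H e = e`; the
  -- exchange needs `r` real. For `r = 1` the inverse is `0` by convention and the matrix is `1`,
  -- which works because the corner of `U` is then `1`.
  refine ⟨1 - (((1 - r)⁻¹ : ℝ) : ℂ) • P, ?_, ?_, ?_⟩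
  · rw [Matrix.conjTranspose_sub, Matrix.conjTranspose_one, Matrix.conjTranspose_smul, hPH,
      Complex.star_def, Complex.conj_ofReal]
  · rw [mul_sub, sub_mul, sub_mul, one_mul, one_mul, mul_one, smul_mul_smul_comm, hPP, smul_smul]
    have hk : (((1 - r)⁻¹ : ℝ) : ℂ) * (((1 - r)⁻¹ : ℝ) : ℂ) * (2 * (1 - r)) =
        2 * (((1 - r)⁻¹ : ℝ) : ℂ) := by
      rcases eq_or_ne r 1 with rfl | h
      · simp
      · have : (1 - r : ℂ) ≠ 0 := by exact_mod_cast sub_ne_zero.2 h.symm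
        push_cast
        field_simp
    rw [hk]
    module
  · rw [mul_sub, mul_one, mul_smul_comm, hP, Matrix.mul_vecMulVec, Matrix.sub_apply,
      Matrix.smul_apply, Matrix.vecMulVec_apply, hUw, Pi.star_apply, hw0, hr, smul_eq_mul,
      Complex.star_def, map_sub, map_one, Complex.conj_ofReal]
    rcases eq_or_ne r 1 with rfl | h
    · simp
    · have : (1 - r : ℂ) ≠ 0 := by exact_mod_cast sub_ne_zero.2 h.symm
      push_cast
      field_simp
      ring

theorem exists_corner_mixture {ε : ℝ} (hε0 : 0 ≤ ε) (hε1 : ε ≤ 1)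
    {U : Matrix (Fin (n + 2)) (Fin (n + 2)) ℂ} (hU : U ∈ Matrix.unitaryGroup (Fin (n + 2)) ℂ)
    {r : ℝ} (hr : U 0 0 = r) :
    ∃ W : Bool → Matrix (Fin (n + 2)) (Fin (n + 2)) ℂ,
      (∀ b, W b ∈ Matrix.unitaryGroup (Fin (n + 2)) ℂ ∧ ε ≤ ‖W b 0 0‖ ∧
        diamondDist (unitaryChannel U) (unitaryChannel (W b)) ≤ ε) ∧
      ∑ b, (2 : ℝ)⁻¹ • W b = √(1 - ε ^ 2) • U := by
  obtain ⟨H, hHH, hH2, hUH⟩ := exists_reflection hU hr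
  set c := √(1 - ε ^ 2) with hc
  have hc2 : c ^ 2 = 1 - ε ^ 2 := Real.sq_sqrt (by nlinarith)
  set s : Bool → ℝ := fun b => if b then ε else -ε with hs
  have hs2 : ∀ b, s b ^ 2 = ε ^ 2 := fun b => by
    simp only [hs]; split_ifs <;> ring
  set G : Bool → Matrix (Fin (n + 2)) (Fin (n + 2)) ℂ :=
    fun b => (c : ℂ) • 1 + (Complex.I * (s b : ℂ)) • H with hG
  have hGH : ∀ b, (G b)ᴴ = (c : ℂ) • 1 - (Complex.I * (s b : ℂ)) • H := by
    intro b
    simp only [hG, Matrix.conjTranspose_add, Matrix.conjTranspose_smul, Matrix.conjTranspose_one,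
      hHH, Complex.star_def, map_mul, Complex.conj_I, Complex.conj_ofReal]
    module
  have hGu : ∀ b, G b ∈ Matrix.unitaryGroup (Fin (n + 2)) ℂ := by
    intro b
    rw [Matrix.mem_unitaryGroup_iff, Matrix.star_eq_conjTranspose, hGH]
    have h1 : (c : ℂ) ^ 2 - (Complex.I * (s b : ℂ)) * (Complex.I * (s b : ℂ)) = 1 := by
      have h2 : (c : ℂ) ^ 2 + (s b : ℂ) ^ 2 = 1 := by
        exact_mod_cast (by rw [hs2, hc2]; ring : c ^ 2 + s b ^ 2 = 1)
      linear_combination h2 - (s b : ℂ) ^ 2 * Complex.I_mul_I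
    simp only [hG, add_mul, mul_sub, smul_mul_smul_comm, mul_one, one_mul, hH2]
    refine Eq.trans ?_ ((congrArg (· • (1 : Matrix (Fin (n + 2)) (Fin (n + 2)) ℂ)) h1).trans
      (one_smul ℂ _))
    module
  have hWu : ∀ b, U * G b ∈ Matrix.unitaryGroup (Fin (n + 2)) ℂ := fun b => mul_mem hU (hGu b)
  refine ⟨fun b => U * G b, fun b => ⟨hWu b, ?_, ?_⟩, ?_⟩
  -- As `r` is real and `(U H) 0 0 = 1`, the imaginary part of the corner is exactly `± ε`, whatever
  -- `r` is.
  · have h1 : (U * G b) 0 0 = (c * r : ℝ) + (s b : ℝ) * Complex.I := by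
      simp only [hG, mul_add, mul_smul_comm, mul_one, Matrix.add_apply, Matrix.smul_apply, hUH, hr,
        smul_eq_mul]
      push_cast
      ring
    have h2 : ((U * G b) 0 0).im = s b := by
      rw [h1]; simp
    have h3 : |s b| = ε := by
      simp only [hs]
      split_ifs
      · exact abs_of_nonneg hε0
      · rw [abs_neg, abs_of_nonneg hε0]
    rw [← h3, ← h2]
    exact Complex.abs_im_le_norm _
  · refine diamondDist_le_of_posSemidef hU (hWu b) hε0 hε1 ?_
    rw [← mul_assoc, ← Matrix.star_eq_conjTranspose U, Matrix.mem_unitaryGroup_iff'.1 hU, one_mul,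
      hGH, ← hc]
    -- The Hermitian part of `U†W = c ± iεH` is exactly `c`.
    have h1 : G b + ((c : ℂ) • 1 - (Complex.I * (s b : ℂ)) • H) - ((2 * c : ℝ) : ℂ) • 1 = 0 := by
      simp only [hG]
      push_cast
      module
    rw [h1]
    exact Matrix.PosSemidef.zero
  · simp only [Fintype.sum_bool, hG, hs, mul_add, mul_smul_comm, mul_one, if_true,
      Bool.false_eq_true, if_false]
    ext i j
    simp
    ring

theorem rotationUnitaries_subset {ε : ℝ} (hε0 : 0 ≤ ε) (hε1 : ε ≤ 1) (hd : 2 ≤ n + 2) :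
    rotationUnitaries (n + 2) hd ε ⊆ Matrix.unitaryGroup (Fin (n + 2)) ℂ :=
  fun _ hV => (rotationUnitaries_corner hε0 hε1 hd hV).1

theorem rotationUnitaries_nonempty {ε : ℝ} (hε1 : ε ≤ 1) (hd : 2 ≤ n + 2) :
    (rotationUnitaries (n + 2) hd ε).Nonempty := by
  obtain ⟨V, hV, -⟩ := unitaryChannel_mem_rotationChannels (ε := ε) hd
    (one_mem (Matrix.unitaryGroup (Fin (n + 2)) ℂ)) (by simpa using hε1)
  exact ⟨V, hV⟩

theorem errors_rotationChannels_le {ε : ℝ} (hε0 : 0 ≤ ε) (hε1 : ε ≤ 1) (hd : 2 ≤ n + 2)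
    {U : Matrix (Fin (n + 2)) (Fin (n + 2)) ℂ} (hU : U ∈ Matrix.unitaryGroup (Fin (n + 2)) ℂ) :
    detError (unitaryChannel U) (rotationChannels (n + 2) hd ε) ≤ ε ∧
      probError (unitaryChannel U) (rotationChannels (n + 2) hd ε) ≤ ε ^ 2 := by
  obtain ⟨z, hz, hzU⟩ := exists_norm_eq_one_mul_eq_norm (U 0 0)
  have hzU' := smul_mem_unitaryGroup hz hU
  obtain ⟨W, hW, hsum⟩ := exists_corner_mixture hε0 hε1 hzU' (r := ‖U 0 0‖)
    (by rw [Matrix.smul_apply, smul_eq_mul, hzU])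
  have hS := image_unitaryChannel_subset (rotationUnitaries_subset hε0 hε1 hd)
  have hmem := fun b => unitaryChannel_mem_rotationChannels hd (hW b).1 (hW b).2.1
  have hc2 : √(1 - ε ^ 2) ^ 2 = 1 - ε ^ 2 := Real.sq_sqrt (by nlinarith)
  rw [← unitaryChannel_smul hz U]
  constructor
  · exact (detError_le (isStateMap_unitaryChannel hzU') hS (hmem true)).trans (hW true).2.2
  · have h := probError_le_of_mixture hzU' hS (fun b => (hW b).1) hmem
      (p := fun _ => (2 : ℝ)⁻¹) (fun _ => by positivity) (by simp) (by rw [hc2]; nlinarith) hsum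
    rwa [hc2, sub_sub_cancel] at h

/-- The target `planeRotation 0 1 0 1` exchanges the first two basis vectors with a factor `i`, so
the entry has modulus `|V 1 0|`. The first column of `V` has norm one and `|V 0 0| ≥ ε`. -/
theorem norm_planeRotation_mul_le {ε : ℝ} (hε0 : 0 ≤ ε) (hε1 : ε ≤ 1) (hd : 2 ≤ n + 2)
    {V : Matrix (Fin (n + 2)) (Fin (n + 2)) ℂ} (hV : V ∈ rotationUnitaries (n + 2) hd ε) :
    ‖((planeRotation 0 1 0 1)ᴴ * V : Matrix (Fin (n + 2)) (Fin (n + 2)) ℂ) 0 0‖ ^ 2 ≤ 1 - ε ^ 2 := by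
  obtain ⟨hVu, hVε⟩ := rotationUnitaries_corner hε0 hε1 hd hV
  have h1 : ((planeRotation 0 1 0 1)ᴴ * V : Matrix (Fin (n + 2)) (Fin (n + 2)) ℂ) 0 0 = -Complex.I * V 1 0 := by
    have h2 : ∀ k : Fin (n + 2),
        (planeRotation 0 1 0 1 : Matrix (Fin (n + 2)) (Fin (n + 2)) ℂ)ᴴ 0 k =
        if k = 1 then -Complex.I else 0 := by
      intro k
      rw [planeRotation_conjTranspose]
      refine Fin.cases ?_ (fun k => Fin.cases ?_ (fun k => ?_) k) k <;>
        simp [planeRotation, Matrix.single_apply, Matrix.one_apply, eq_comm (a := (1 : Fin (n + 2)))]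
      split_ifs <;> simp
    rw [Matrix.mul_apply]
    simp only [h2, ite_mul, zero_mul, Finset.sum_ite_eq', Finset.mem_univ, if_true]
  have h3 := sum_norm_sq_col hVu 0
  rw [Fin.sum_univ_succ, Fin.sum_univ_succ, Fin.succ_zero_eq_one] at h3
  have h4 : 0 ≤ ∑ i : Fin n, ‖V i.succ.succ 0‖ ^ 2 := Finset.sum_nonneg fun _ _ => sq_nonneg _
  rw [h1, norm_mul, norm_neg, Complex.norm_I, one_mul]
  nlinarith

theorem le_errors_rotationChannels {ε : ℝ} (hε0 : 0 ≤ ε) (hε1 : ε ≤ 1) (hd : 2 ≤ n + 2) :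
    ε ≤ detError (unitaryChannel (planeRotation 0 1 0 1)) (rotationChannels (n + 2) hd ε) ∧
      ε ^ 2 ≤ probError (unitaryChannel (planeRotation 0 1 0 1))
        (rotationChannels (n + 2) hd ε) := by
  have hU : (planeRotation 0 1 0 1 : Matrix (Fin (n + 2)) (Fin (n + 2)) ℂ) ∈
      Matrix.unitaryGroup (Fin (n + 2)) ℂ :=
    planeRotation_mem_unitaryGroup (by norm_num) zero_ne_one
  have hne := rotationUnitaries_nonempty (n := n) hε1 hd
  have hsub := rotationUnitaries_subset (n := n) hε0 hε1 hd
  -- One unentangled input, the first basis vector, witnesses both lower bounds: its overlaps are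
  -- the corner entries of the relative unitaries.
  set Φ : Fin (n + 2) × Fin (n + 2) → ℂ := productVec (Pi.single 0 1) 0 with hΦ
  have hΦ1 : star Φ ⬝ᵥ Φ = 1 := by
    rw [hΦ, star_productVec_dotProduct_self]
    simp
  have hov : ∀ K : Matrix (Fin (n + 2)) (Fin (n + 2)) ℂ, star Φ ⬝ᵥ localMul K Φ = K 0 0 := by
    intro K
    rw [hΦ, star_productVec_dotProduct_localMul]
    simp
  constructor
  · refine le_detError (hne.image _) ?_
    rintro _ ⟨V, hV, rfl⟩
    refine le_diamondDist_unitaryChannel hU (hsub hV) hΦ1 ?_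
    rw [hov]
    exact norm_planeRotation_mul_le hε0 hε1 hd hV
  · refine le_probError hU hsub hne hΦ1 fun V hV => ?_
    rw [hov]
    exact norm_planeRotation_mul_le hε0 hε1 hd hV

theorem isWorst_rotationChannels {ε : ℝ} (hε0 : 0 ≤ ε) (hε1 : ε ≤ 1) (hd : 2 ≤ n + 2) :
    IsWorstDetError (rotationChannels (n + 2) hd ε) ε ∧
      IsWorstProbError (rotationChannels (n + 2) hd ε) (ε ^ 2) := by
  have hU : (planeRotation 0 1 0 1 : Matrix (Fin (n + 2)) (Fin (n + 2)) ℂ) ∈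
      Matrix.unitaryGroup (Fin (n + 2)) ℂ :=
    planeRotation_mem_unitaryGroup (by norm_num) zero_ne_one
  obtain ⟨h1, h2⟩ := le_errors_rotationChannels (n := n) hε0 hε1 hd
  obtain ⟨h3, h4⟩ := errors_rotationChannels_le hε0 hε1 hd hU
  refine ⟨⟨⟨_, hU, h1.antisymm h3⟩, ?_⟩, ⟨⟨_, hU, h2.antisymm h4⟩, ?_⟩⟩
  · rintro _ ⟨U, hU, rfl⟩
    exact (errors_rotationChannels_le hε0 hε1 hd hU).1
  · rintro _ ⟨U, hU, rfl⟩
    exact (errors_rotationChannels_le hε0 hε1 hd hU).2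

theorem errors_comp_hullChannels {d : ℕ} {ε : ℝ} {U : Matrix (Fin d) (Fin d) ℂ}
    (hU : U ∈ Matrix.unitaryGroup (Fin d) ℂ) {S : Set (SuperOp d)} (hS : S ⊆ hullChannels d ε) :
    detError (unitaryChannel U) ((fun Γ => unitaryChannel U ∘ₗ Γ) '' S) =
        detError LinearMap.id S ∧
      probError (unitaryChannel U) ((fun Γ => unitaryChannel U ∘ₗ Γ) '' S) =
        probError LinearMap.id S := by
  have hS' := hS.trans (image_unitaryChannel_subset (hullUnitaries_subset d ε))
  have h1 := detError_comp hU isStateMap_id hS'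
  have h2 := probError_comp hU isStateMap_id hS'
  rw [LinearMap.comp_id] at h1 h2
  exact ⟨h1, h2⟩

end UpperBound

end ProbSynth

/-! ### Exact attainment and approximation by finite subsets -/

theorem mainTheorem7 (d : ℕ) (hd : 2 ≤ d) (ε : ℝ) (hε0 : 0 ≤ ε) (hε1 : ε ≤ 1) :
    -- lower bound: exact attainment for the target `id` and in the worst case
    (ProbSynth.detError LinearMap.id (ProbSynth.hullChannels d ε) = ε ∧
      ProbSynth.probError LinearMap.id (ProbSynth.hullChannels d ε) =
        ProbSynth.lowerBound d ε ∧
      ProbSynth.IsWorstDetError (ProbSynth.hullChannels d ε) ε ∧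
      ProbSynth.IsWorstProbError (ProbSynth.hullChannels d ε) (ProbSynth.lowerBound d ε)) ∧
    -- lower bound: finite subsets come arbitrarily close to their own lower bounds
    (∀ η : ℝ, 0 < η → ∃ S : Finset (ProbSynth.SuperOp d), S.Nonempty ∧
      (S : Set (ProbSynth.SuperOp d)) ⊆ ProbSynth.hullChannels d ε ∧
      |ProbSynth.detError LinearMap.id (S : Set (ProbSynth.SuperOp d)) - ε| ≤ η ∧
      |ProbSynth.probError LinearMap.id (S : Set (ProbSynth.SuperOp d)) -
        ProbSynth.lowerBound d (ProbSynth.detError LinearMap.id (S : Set (ProbSynth.SuperOp d)))| ≤ η ∧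
      ∃ e v : ℝ, ProbSynth.IsWorstDetError (S : Set (ProbSynth.SuperOp d)) e ∧
        ProbSynth.IsWorstProbError (S : Set (ProbSynth.SuperOp d)) v ∧
        |e - ε| ≤ η ∧ |v - ProbSynth.lowerBound d e| ≤ η) ∧
    -- lower bound: arbitrary unitary target, with the set composed with the target
    (∀ U ∈ Matrix.unitaryGroup (Fin d) ℂ,
      (ProbSynth.detError (ProbSynth.unitaryChannel U)
          ((fun Γ => ProbSynth.unitaryChannel U ∘ₗ Γ) '' ProbSynth.hullChannels d ε) = ε ∧
        ProbSynth.probError (ProbSynth.unitaryChannel U)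
          ((fun Γ => ProbSynth.unitaryChannel U ∘ₗ Γ) '' ProbSynth.hullChannels d ε) =
            ProbSynth.lowerBound d ε) ∧
      ∀ η : ℝ, 0 < η → ∃ S : Finset (ProbSynth.SuperOp d), S.Nonempty ∧
        (S : Set (ProbSynth.SuperOp d)) ⊆
          (fun Γ => ProbSynth.unitaryChannel U ∘ₗ Γ) '' ProbSynth.hullChannels d ε ∧
        |ProbSynth.detError (ProbSynth.unitaryChannel U) (S : Set (ProbSynth.SuperOp d)) - ε| ≤ η ∧
        |ProbSynth.probError (ProbSynth.unitaryChannel U) (S : Set (ProbSynth.SuperOp d)) -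
          ProbSynth.lowerBound d (ProbSynth.detError (ProbSynth.unitaryChannel U) (S : Set (ProbSynth.SuperOp d)))| ≤ η) ∧
    -- upper bound: exact attainment in the worst case
    (ProbSynth.IsWorstDetError (ProbSynth.rotationChannels d hd ε) ε ∧
      ProbSynth.IsWorstProbError (ProbSynth.rotationChannels d hd ε) (ε ^ 2)) ∧
    -- upper bound: finite subsets come arbitrarily close to their own upper bounds
    (∀ η : ℝ, 0 < η → ∃ S : Finset (ProbSynth.SuperOp d), S.Nonempty ∧
      (S : Set (ProbSynth.SuperOp d)) ⊆ ProbSynth.rotationChannels d hd ε ∧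
      ∃ e v : ℝ, ProbSynth.IsWorstDetError (S : Set (ProbSynth.SuperOp d)) e ∧
        ProbSynth.IsWorstProbError (S : Set (ProbSynth.SuperOp d)) v ∧
        |e - ε| ≤ η ∧ |v - e ^ 2| ≤ η) := by
  classical
  obtain ⟨hdet, hprob⟩ := ProbSynth.errors_id_hullChannels hd hε0 hε1
  obtain ⟨hwd, hwp⟩ := ProbSynth.isWorst_hullChannels hd hε0 hε1
  have hfin := fun η (hη : (0 : ℝ) < η) => ProbSynth.exists_finset_errors_relation
    (ProbSynth.hullUnitaries_subset d ε) (ProbSynth.hullUnitaries_nonempty hd hε0 hε1)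
    (ProbSynth.continuous_lowerBound d) ε hη
  refine ⟨⟨hdet, hprob, hwd, hwp⟩, fun η hη => ?_, fun U hU => ⟨?_, fun η hη => ?_⟩, ?_, ?_⟩
  · obtain ⟨S, hne, hsub, herr, hworst⟩ := hfin η hη
    obtain ⟨h1, h2⟩ := herr _ ProbSynth.isStateMap_id hdet hprob
    exact ⟨S, hne, hsub, h1, h2, hworst hwd hwp⟩
  · obtain ⟨h1, h2⟩ := ProbSynth.errors_comp_hullChannels (ε := ε) hU subset_rfl
    exact ⟨h1.trans hdet, h2.trans hprob⟩
  · obtain ⟨S, hne, hsub, herr, -⟩ := hfin η hη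
    obtain ⟨h1, h2⟩ := herr _ ProbSynth.isStateMap_id hdet hprob
    obtain ⟨h3, h4⟩ := ProbSynth.errors_comp_hullChannels hU hsub
    -- The finite set for the target `U` is the translate of the one for the identity; unitary
    -- invariance leaves both errors unchanged.
    refine ⟨S.image fun Γ => ProbSynth.unitaryChannel U ∘ₗ Γ, hne.image _, ?_⟩
    rw [Finset.coe_image, h3, h4]
    exact ⟨Set.image_mono hsub, h1, h2⟩
  · obtain ⟨n, rfl⟩ : ∃ n, d = n + 2 := ⟨d - 2, by omega⟩
    exact ProbSynth.isWorst_rotationChannels hε0 hε1 hd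
  · intro η hη
    obtain ⟨n, rfl⟩ : ∃ n, d = n + 2 := ⟨d - 2, by omega⟩
    obtain ⟨hvd, hvp⟩ := ProbSynth.isWorst_rotationChannels hε0 hε1 hd
    obtain ⟨S, hne, hsub, -, hworst⟩ := ProbSynth.exists_finset_errors_relation
      (ProbSynth.rotationUnitaries_subset hε0 hε1 hd)
      (ProbSynth.rotationUnitaries_nonempty hε1 hd) (continuous_pow 2) ε hη
    exact ⟨S, hne, hsub, hworst hvd hvp⟩
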